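/- Let $\mathbb{F}_q$ be a finite field with $q$ odd, $(V,\omega)$ a $2n$-dimensional symplectic vector space over $\mathbb{F}_q$, $\psi:\mathbb{F}_q\to\mathbb{C}^\times$ a non-trivial additive character, and $H(V)=V\times\mathbb{F}_q$ the Heisenberg group, with product $(v,z)(v',z')=(v+v',\,z+z'+\tfrac12\omega(v,v'))$. An oriented Lagrangian is a pair $L^\circ=(L,o_L)$ with $L\subset V$ Lagrangian and $0\neq o_L\in\bigwedge^{top}L$; $OLag(V)$ is the set of these. Let $\mathcal{H}_{L^\circ}$ be the space of functions $f:H(V)\to\mathbb{C}$ with $f((0,z)\cdot h)=\psi(z)f(h)$ and $f((l,0)\cdot h)=f(h)$ for $z\in\mathbb{F}_q$, $l\in L$, on which $H(V)$ acts by right translation. A trivialization is a system of $H(V)$-intertwining isomorphisms $T_{M^\circ,L^\circ}:\mathcal{H}_{L^\circ}\to\mathcal{H}_{M^\circ}$, for all $(M^\circ,L^\circ)\in OLag(V)^2$, with $T_{N^\circ,M^\circ}\circ T_{M^\circ,L^\circ}=T_{N^\circ,L^\circ}$ for all $N^\circ,M^\circ,L^\circ$. Let $\sigma$ be the quadratic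 character of $\mathbb{F}_q^\times$ and $G_1=\sum_{z\in\mathbb{F}_q}\psi(\tfrac12z^2)$. Pairings $\omega_\wedge$ of $k$-th exterior powers induced by $\omega$ are normalized by $$\omega_\wedge(a_1\wedge\dots\wedge a_k,\;b_1\wedge\dots\wedge b_k)=(-1)^{\binom k2}\det(\omega(a_i,b_j)).$$ There is a unique trivialization $\{T_{M^\circ,L^\circ}\}$ (whose members are called the canonical intertwining morphisms) such that, whenever $L+M=V$, $$T_{M^\circ,L^\circ}[f](h)=(G_1/q)^n\,\sigma\big((-1)^{\binom n2}\omega_\wedge(o_L,o_M)\big)\sum_{m\in M}f((m,0)\cdot h).$$ For an arbitrary pair $(M^\circ,L^\circ)\in OLag(V)^2$ put $I=M\cap L$ and $n_I=\tfrac12\dim(I^\perp/I)$. By means of the canonical isomorphisms $\bigwedge^{top}M=\bigwedge^{top}I\otimes\bigwedge^{top}(M/I)$ and $\bigwedge^{top}L=\bigwedge^{top}I\otimes\bigwedge^{top}(L/I)$ (where $\iota\otimes q$ corresponds to $\iota\wedge y$ for any lift $y$ of $q$), the orientations can be written as $o_M=\iota_M\otimes o_{M/I}$ and $o_L=\iota_L\otimes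 o_{L/I}$, and for every such way of writing them $$T_{M^\circ,L^\circ}=A_{M^\circ,L^\circ}\cdot F_{M^\circ,L^\circ},$$ where $F_{M^\circ,L^\circ}:\mathcal{H}_{L^\circ}\to\mathcal{H}_{M^\circ}$ is the averaging morphism $$F_{M^\circ,L^\circ}[f](h)=\sum_{\overline m\in M/I}f((m,0)\cdot h)$$ with $m\in M$ any element over $\overline m$, and $$A_{M^\circ,L^\circ}=(G_1/q)^{n_I}\,\sigma\Big((-1)^{\binom{n_I}2}\,\frac{\iota_L}{\iota_M}\,\omega_\wedge(o_{L/I},o_{M/I})\Big).$$ Here $\iota_L/\iota_M\in\mathbb{F}_q^\times$ is the scalar $c$ with $\iota_L=c\,\iota_M$. -/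

import Mathlib

namespace StrongSvN

open Module

section Heisenberg

variable {F V : Type*} [Field F] [AddCommGroup V] [Module F V]

/-- The underlying set `V × F` of the Heisenberg group of `(V, ω)`. -/
@[ext]
structure Heisenberg (ω : LinearMap.BilinForm F V) where
  vec : V
  cen : F

namespace Heisenberg

variable {ω : LinearMap.BilinForm F V}

/-- `(v, z) · (v', z') = (v + v', z + z' + ½ ω(v, v'))`. -/
instance : Mul (Heisenberg ω) :=
  ⟨fun a b => ⟨a.vec + b.vec, a.cen + b.cen + (2 : F)⁻¹ * ω a.vec b.vec⟩⟩

instance : One (Heisenberg ω) := ⟨⟨0, 0⟩⟩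

/-- The inverse; the last term vanishes for alternating `ω`. -/
instance : Inv (Heisenberg ω) :=
  ⟨fun a => ⟨-a.vec, -a.cen + (2 : F)⁻¹ * ω a.vec a.vec⟩⟩

@[simp] theorem mul_vec (a b : Heisenberg ω) : (a * b).vec = a.vec + b.vec := rfl

@[simp] theorem mul_cen (a b : Heisenberg ω) :
    (a * b).cen = a.cen + b.cen + (2 : F)⁻¹ * ω a.vec b.vec := rfl

@[simp] theorem one_vec : (1 : Heisenberg ω).vec = 0 := rfl

@[simp] theorem one_cen : (1 : Heisenberg ω).cen = 0 := rfl

@[simp] theorem inv_vec (a : Heisenberg ω) : (a⁻¹).vec = -a.vec := rfl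

@[simp] theorem inv_cen (a : Heisenberg ω) :
    (a⁻¹).cen = -a.cen + (2 : F)⁻¹ * ω a.vec a.vec := rfl

instance : Group (Heisenberg ω) :=
  Group.ofLeftAxioms
    (fun a b c => by
      ext
      · simp [add_assoc]
      · simp; ring)
    (fun a => by ext <;> simp)
    (fun a => by ext <;> simp)

/-- The central element `(0, z)`. -/
def ofCen (ω : LinearMap.BilinForm F V) (z : F) : Heisenberg ω := ⟨0, z⟩

/-- The element `(v, 0)`. -/
def ofVec (ω : LinearMap.BilinForm F V) (v : V) : Heisenberg ω := ⟨v, 0⟩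

theorem ofVec_mul_ofCen (v : V) (z : F) : ofVec ω v * ofCen ω z = ofCen ω z * ofVec ω v := by
  ext <;> simp [ofVec, ofCen]

theorem ofVec_mul_ofVec {v w : V} (h : ω v w = 0) :
    ofVec ω v * ofVec ω w = ofVec ω (v + w) := by
  ext <;> simp [ofVec, h]

end Heisenberg

open Heisenberg

/-- The space `H_L` of functions `f` on the Heisenberg group such that `f (z · h) = ψ z • f h` for
central `z` and `f (l · h) = f h` for `l ∈ L`. -/
def model (ω : LinearMap.BilinForm F V) (ψ : AddChar F ℂ) (L : Submodule F V) :
    Submodule ℂ (Heisenberg ω → ℂ) where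
  carrier := {f | (∀ z h, f (ofCen ω z * h) = ψ z * f h) ∧ ∀ l ∈ L, ∀ h, f (ofVec ω l * h) = f h}
  zero_mem' := by simp
  add_mem' := by
    rintro f g ⟨hf, hf'⟩ ⟨hg, hg'⟩
    refine ⟨fun z h => ?_, fun l hl h => ?_⟩
    · simp [hf, hg, mul_add]
    · simp [hf' l hl, hg' l hl]
  smul_mem' := by
    rintro c f ⟨hf, hf'⟩
    refine ⟨fun z h => ?_, fun l hl h => ?_⟩
    · simp [hf, mul_left_comm]
    · simp [hf' l hl]

/-- The Heisenberg action on `H_L` by right translation: `(π_L(h) f)(h') = f (h' · h)`. -/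
def rep (ω : LinearMap.BilinForm F V) (ψ : AddChar F ℂ) (L : Submodule F V) :
    Representation ℂ (Heisenberg ω) (model ω ψ L) where
  toFun h :=
    { toFun := fun f => ⟨fun h' => f.1 (h' * h),
        fun z h' => by simp only [mul_assoc]; exact f.2.1 z _,
        fun l hl h' => by simp only [mul_assoc]; exact f.2.2 l hl _⟩
      map_add' := fun _ _ => rfl
      map_smul' := fun _ _ => rfl }
  map_one' := by ext f h'; simp
  map_mul' a b := by ext f h'; simp [mul_assoc]

/-- `L` is Lagrangian: it equals its own orthogonal complement. -/
def IsLagrangian (ω : LinearMap.BilinForm F V) (L : Submodule F V) : Prop :=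
  ω.orthogonal L = L

theorem IsLagrangian.apply_eq_zero {ω : LinearMap.BilinForm F V} {L : Submodule F V}
    (h : IsLagrangian ω L) {v w : V} (hv : v ∈ L) (hw : w ∈ L) : ω v w = 0 :=
  LinearMap.BilinForm.mem_orthogonal_iff.1 (h.symm ▸ hw : w ∈ ω.orthogonal L) v hv

/-- Oriented Lagrangians `(L, o_L)`. When `ω` is symplectic and `dim V = 2n`, every Lagrangian has
dimension `n`, so that `⋀ⁿ L` is the top exterior power of `L`. -/
structure OLag (ω : LinearMap.BilinForm F V) (n : ℕ) where
  carrier : Submodule F V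
  isLagrangian : IsLagrangian ω carrier
  orient : ⋀[F]^n carrier
  orient_ne_zero : orient ≠ 0

variable {ω : LinearMap.BilinForm F V} {n : ℕ}

/-- A system of linear maps `H_L → H_M`, one for each pair of oriented Lagrangians. -/
abbrev System (ω : LinearMap.BilinForm F V) (n : ℕ) (ψ : AddChar F ℂ) :=
  ∀ M L : OLag ω n, model ω ψ L.carrier →ₗ[ℂ] model ω ψ M.carrier

/-- A trivialization: a multiplicative system of intertwining isomorphisms. -/
structure IsTrivialization (ψ : AddChar F ℂ) (T : System ω n ψ) : Prop where
  intertwines : ∀ M L h f, T M L (rep ω ψ L.carrier h f) = rep ω ψ M.carrier h (T M L f)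
  bijective : ∀ M L, Function.Bijective (T M L)
  mult : ∀ N M L, T N M ∘ₗ T M L = T N L

end Heisenberg

section Exterior

variable {F X Y : Type*} [Field F] [AddCommGroup X] [Module F X] [AddCommGroup Y] [Module F Y]

/-- The pairing `⋀ᵏ X × ⋀ᵏ Y → F` induced by a bilinear map `B : X × Y → F`, with the sign
convention `(x₁ ∧ … ∧ xₖ, y₁ ∧ … ∧ yₖ) ↦ (-1)^(k choose 2) det (B(xᵢ, yⱼ))`. -/
noncomputable def wedgePairing (B : X →ₗ[F] Y →ₗ[F] F) (k : ℕ) :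
    ⋀[F]^k X →ₗ[F] ⋀[F]^k Y →ₗ[F] F :=
  (-1 : F) ^ (k.choose 2) •
    (exteriorPower.pairingDual F Y k ∘ₗ exteriorPower.map k (B : X →ₗ[F] Module.Dual F Y))

theorem wedgePairing_ιMulti (B : X →ₗ[F] Y →ₗ[F] F) (k : ℕ) (x : Fin k → X) (y : Fin k → Y) :
    wedgePairing B k (exteriorPower.ιMulti F k x) (exteriorPower.ιMulti F k y) =
      (-1 : F) ^ (k.choose 2) * (Matrix.of fun i j => B (x i) (y j)).det := by
  simp only [wedgePairing, LinearMap.smul_apply, LinearMap.comp_apply,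
    exteriorPower.map_apply_ιMulti, exteriorPower.pairingDual_ιMulti_ιMulti, smul_eq_mul]
  rw [← Matrix.det_transpose]
  rfl

/-- The ratio `x / y` of two vectors of a line with `y ≠ 0`: the scalar `c` with `x = c • y`. -/
noncomputable def lineRatio (x y : X) : F :=
  Classical.epsilon fun c : F => x = c • y

/-- For a subspace `I` of `W`, a way of writing `o ∈ ⋀ⁿ W` in the form `ι ⊗ q` with
`ι ∈ ⋀ᵏ I`, `k = dim I`, and `q ∈ ⋀ʳ (W / I)`. Here `ι ⊗ q` corresponds to `ι ∧ y ∈ ⋀ W`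
for any `y ∈ ⋀ʳ W` lying over `q`; the product does not depend on `y` as `ι` is of top degree. -/
structure OrientSplitting {W I : Submodule F X} (hI : I ≤ W) (r : ℕ) {n : ℕ} (o : ⋀[F]^n W) where
  sub : ⋀[F]^(finrank F I) I
  quot : ⋀[F]^r (W ⧸ I.submoduleOf W)
  spec : ∃ y : ⋀[F]^r W, exteriorPower.map r (I.submoduleOf W).mkQ y = quot ∧
    (o : ExteriorAlgebra F W) =
      ExteriorAlgebra.map (Submodule.inclusion hI) (sub : ExteriorAlgebra F I) * y

end Exterior

section Canonical

open Heisenberg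

variable {F V : Type*} [Field F] [AddCommGroup V] [Module F V]
  {ω : LinearMap.BilinForm F V} {n : ℕ}

/-- The pairing `L × M → F` given by `ω`. -/
def pairing (M L : OLag ω n) : L.carrier →ₗ[F] M.carrier →ₗ[F] F :=
  ω.domRestrict₁₂ L.carrier M.carrier

/-- The intersection `I = M ∩ L`. -/
abbrev inter (M L : OLag ω n) : Submodule F V := M.carrier ⊓ L.carrier

theorem inter_le_left (M L : OLag ω n) : inter M L ≤ M.carrier := inf_le_left

theorem inter_le_right (M L : OLag ω n) : inter M L ≤ L.carrier := inf_le_right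

/-- `n_I = dim (I^⊥ / I) / 2` for `I = M ∩ L`. -/
noncomputable def halfDim (M L : OLag ω n) : ℕ :=
  finrank F (ω.orthogonal (inter M L) ⧸ (inter M L).submoduleOf (ω.orthogonal (inter M L))) / 2

/-- The pairing `L/I × M/I → F` induced by `ω`, where `I = M ∩ L`. -/
def quotPairing (M L : OLag ω n) :
    (L.carrier ⧸ (inter M L).submoduleOf L.carrier) →ₗ[F]
      (M.carrier ⧸ (inter M L).submoduleOf M.carrier) →ₗ[F] F :=
  ((inter M L).submoduleOf L.carrier).liftQ
    { toFun := fun l => ((inter M L).submoduleOf M.carrier).liftQ (pairing M L l)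
        (fun m hm => L.isLagrangian.apply_eq_zero l.2 hm.2)
      map_add' := fun a b => by
        ext m
        exact LinearMap.congr_fun ((pairing M L).map_add a b) m
      map_smul' := fun c a => by
        ext m
        exact LinearMap.congr_fun ((pairing M L).map_smul c a) m }
    (fun l hl => by
      ext m
      exact M.isLagrangian.apply_eq_zero hl.1 m.2)

@[simp] theorem quotPairing_mk (M L : OLag ω n) (l : L.carrier) (m : M.carrier) :
    quotPairing M L (Submodule.Quotient.mk l) (Submodule.Quotient.mk m) = ω l m := rfl

/-- For `f ∈ H_L`, the value `f (m · h)` depends only on the class of `m` in `M / (M ∩ L)`. -/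
theorem model_apply_congr {ψ : AddChar F ℂ} {M L : OLag ω n} (f : model ω ψ L.carrier)
    {m m' : M.carrier}
    (hm : (Submodule.Quotient.mk m : M.carrier ⧸ (inter M L).submoduleOf M.carrier) =
      Submodule.Quotient.mk m') (h : Heisenberg ω) :
    f.1 (ofVec ω m * h) = f.1 (ofVec ω m' * h) := by
  have hI := (Submodule.Quotient.eq _).1 hm
  have h1 : ((m - m' : M.carrier) : V) ∈ L.carrier := hI.2
  have h2 : ofVec ω ((m - m' : M.carrier) : V) * ofVec ω (m' : V) = ofVec ω (m : V) := by
    rw [ofVec_mul_ofVec (M.isLagrangian.apply_eq_zero (m - m').2 m'.2)]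
    simp
  rw [← h2, mul_assoc, f.2.2 _ h1]

variable [Fintype F]

/-- The Gauss sum `G₁ = ∑ z, ψ(z²/2)`. -/
noncomputable def gaussOne (ψ : AddChar F ℂ) : ℂ := ∑ z : F, ψ ((2 : F)⁻¹ * z ^ 2)

section Averaging

variable [FiniteDimensional F V]

/-- The averaging morphism `H_L → H_M`, `f ↦ (h ↦ ∑_{m ∈ M} f (m · h))`. -/
noncomputable def fullAverage (ψ : AddChar F ℂ) (M L : OLag ω n) :
    model ω ψ L.carrier →ₗ[ℂ] model ω ψ M.carrier :=
  haveI : Finite V := Module.finite_of_finite F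
  letI := Fintype.ofFinite M.carrier
  { toFun := fun f => ⟨fun h => ∑ m : M.carrier, f.1 (ofVec ω m * h), by
      refine ⟨fun z h => ?_, fun l hl h => ?_⟩
      · rw [Finset.mul_sum]
        refine Finset.sum_congr rfl fun m _ => ?_
        rw [← mul_assoc, ofVec_mul_ofCen, mul_assoc, f.2.1]
      · refine Fintype.sum_equiv (Equiv.addRight (⟨l, hl⟩ : M.carrier)) _ _ fun m => ?_
        rw [← mul_assoc, ofVec_mul_ofVec (M.isLagrangian.apply_eq_zero m.2 hl)]
        rfl⟩
    map_add' := fun f g => by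
      ext h
      exact Finset.sum_add_distrib
    map_smul' := fun c f => by
      ext h
      exact (Finset.mul_sum _ _ _).symm }

/-- The averaging morphism `H_L → H_M`, `f ↦ (h ↦ ∑_{m̄ ∈ M/I} f (m · h))` with `I = M ∩ L`, where
`m ∈ M` is any element over `m̄`. -/
noncomputable def average (ψ : AddChar F ℂ) (M L : OLag ω n) :
    model ω ψ L.carrier →ₗ[ℂ] model ω ψ M.carrier :=
  haveI : Finite V := Module.finite_of_finite F
  haveI : Finite (M.carrier ⧸ (inter M L).submoduleOf M.carrier) := Quotient.finite _
  letI := Fintype.ofFinite (M.carrier ⧸ (inter M L).submoduleOf M.carrier)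
  { toFun := fun f => ⟨fun h =>
      ∑ q : M.carrier ⧸ (inter M L).submoduleOf M.carrier,
        f.1 (ofVec ω (Quotient.out q : M.carrier) * h), by
      refine ⟨fun z h => ?_, fun l hl h => ?_⟩
      · rw [Finset.mul_sum]
        refine Finset.sum_congr rfl fun m _ => ?_
        rw [← mul_assoc, ofVec_mul_ofCen, mul_assoc, f.2.1]
      · refine Fintype.sum_equiv (Equiv.addRight (Submodule.Quotient.mk (⟨l, hl⟩ : M.carrier)))
          _ _ fun q => ?_
        rw [← mul_assoc, ofVec_mul_ofVec (M.isLagrangian.apply_eq_zero (Quotient.out q).2 hl)]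
        refine model_apply_congr f (m := Quotient.out q + ⟨l, hl⟩) ?_ h
        have e : ∀ x : M.carrier ⧸ (inter M L).submoduleOf M.carrier,
            Submodule.Quotient.mk (Quotient.out x) = x := fun x => Quotient.out_eq x
        rw [Submodule.Quotient.mk_add, e, e]
        rfl⟩
    map_add' := fun f g => by
      ext h
      exact Finset.sum_add_distrib
    map_smul' := fun c f => by
      ext h
      exact (Finset.mul_sum _ _ _).symm }

end Averaging

variable [DecidableEq F]

/-- The normalization constant for `M`, `L` in general position:
`(G₁/q)ⁿ σ((-1)^(n choose 2) ω_∧(o_L, o_M))`. -/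
noncomputable def genericConst (ψ : AddChar F ℂ) (M L : OLag ω n) : ℂ :=
  (gaussOne ψ / (Fintype.card F : ℂ)) ^ n *
    (quadraticChar F ((-1) ^ (n.choose 2) *
      wedgePairing (pairing M L) n L.orient M.orient) : ℂ)

/-- The canonical system: the trivialization that is given by the explicit ansatz on pairs in
general position. -/
structure IsCanonical [FiniteDimensional F V] (ψ : AddChar F ℂ) (T : System ω n ψ) : Prop
    extends IsTrivialization ψ T where
  ansatz : ∀ M L : OLag ω n, L.carrier ⊔ M.carrier = ⊤ →
    T M L = genericConst ψ M L • fullAverage ψ M L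

/-- The normalization constant for arbitrary `M`, `L`:
`(G₁/q)^(n_I) σ((-1)^(n_I choose 2) (ι_L/ι_M) ω_∧(o_{L/I}, o_{M/I}))`, for orientations written
as `o_M = ι_M ⊗ o_{M/I}` and `o_L = ι_L ⊗ o_{L/I}`. -/
noncomputable def normConst (ψ : AddChar F ℂ) (M L : OLag ω n)
    (sM : OrientSplitting (inter_le_left M L) (halfDim M L) M.orient)
    (sL : OrientSplitting (inter_le_right M L) (halfDim M L) L.orient) : ℂ :=
  (gaussOne ψ / (Fintype.card F : ℂ)) ^ halfDim M L *
    (quadraticChar F ((-1) ^ ((halfDim M L).choose 2) * lineRatio (F := F) sL.sub sM.sub *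
      wedgePairing (quotPairing M L) (halfDim M L) sL.quot sM.quot) : ℂ)

end Canonical

end StrongSvN

open StrongSvN

namespace StrongSvN

open Module Heisenberg

/-! ### Quadratic Gauss sums over the finite field. -/

section GaussSums

variable {F : Type*} [Field F] [Fintype F] [DecidableEq F]

/-! If `K` is transversal to both `L` and `M`, multiplicativity forces `T_{M,L} = T_{M,K} ∘
T_{K,L}`, and the ansatz prescribes both factors. Uniqueness follows once such a `K` exists;
existence and the explicit formula follow from computing this composite and finding that the answer
does not involve `K`.

Write `I = M ∩ L`, `i = dim I`, `r = n - i = n_I`. The composite of the unnormalized averages is a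
double sum of `f(k · m · h)` over `k ∈ K`, `m ∈ M`. If `k ∉ M + L = I^⊥`, the sum over `m` vanishes
by averaging a nontrivial character over a line in `I`. If `k = λ + μ` with `λ ∈ L`, `μ ∈ M`, it is
`ψ(-½ ω(λ, μ))` times the average over `M` (`fullAverage_comp_fullAverage`). What remains is the
Gauss sum of a nondegenerate quadratic form on the `r`-dimensional space `K ∩ (M + L)`, namely `G₁ ^
r` times `σ` of its discriminant.

In bases of `L`, `K`, `M` adapted to `I` and this form (`exists_adapted_families`), the pairings of
`L` with `K` and of `K` with `M` become block triangular, and the discriminant and both pairings are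
expressed by one determinant `det ω(l_s, m_t)`. With `G₁ ^ 2 = σ(-1) q`, all contributions of `K`
cancel (`exists_families_comp`, `normalization_identity`), leaving `A_{M,L} F_{M,L}`.
Multiplicativity on a triple follows by inserting a `K` transversal to all three Lagrangians, which
exists because `q ≥ 3`. -/

theorem quadraticChar_cast_mul (a b : F) :
    (quadraticChar F (a * b) : ℂ) = quadraticChar F a * quadraticChar F b := by
  rw [map_mul, Int.cast_mul]

theorem quadraticChar_cast_mul_self {a : F} (ha : a ≠ 0) :
    (quadraticChar F a : ℂ) * quadraticChar F a = 1 := by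
  rw [← quadraticChar_cast_mul, ← sq, quadraticChar_sq_one' ha, Int.cast_one]

theorem quadraticChar_cast_neg_one_pow (k : ℕ) :
    (quadraticChar F ((-1) ^ k) : ℂ) = (quadraticChar F (-1) : ℂ) ^ k := by
  rw [map_pow, Int.cast_pow]

/-- An element `y` has `1 + σ(y)` square roots. The summand `1` gives a full character sum, which
vanishes; `σ(y)` gives a Gauss sum for a rescaled character. -/
theorem sum_addChar_mul_sq (hF : ringChar F ≠ 2) {ψ : AddChar F ℂ} (hψ : ψ ≠ 1) {a : F}
    (ha : a ≠ 0) :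
    ∑ z : F, ψ (a * z ^ 2) =
      quadraticChar F a * gaussSum ((quadraticChar F).ringHomComp (Int.castRingHom ℂ)) ψ := by
  have hsum : ∑ y : F, ψ (a * y) = 0 := by
    have := AddChar.sum_mulShift a (AddChar.IsPrimitive.of_ne_one hψ)
    simpa [ha, mul_comm] using this
  have h1 : ∑ z : F, ψ (a * z ^ 2) = ∑ y : F, ((quadraticChar F y : ℂ) + 1) * ψ (a * y) := by
    rw [← Finset.sum_fiberwise (s := Finset.univ) (g := fun z : F => z ^ 2)]
    refine Finset.sum_congr rfl fun y _ => ?_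
    rw [Finset.sum_congr rfl (g := fun _ => ψ (a * y))
      (fun z hz => by rw [(Finset.mem_filter.1 hz).2]), Finset.sum_const, nsmul_eq_mul]
    have h2 := quadraticChar_card_sqrts hF y
    have h3 : {x : F | x ^ 2 = y}.toFinset = Finset.univ.filter (fun z : F => z ^ 2 = y) := by
      ext; simp
    rw [h3] at h2
    have h4 := congrArg (Int.cast : ℤ → ℂ) h2
    push_cast at h4
    rw [h4]
  have h2 : gaussSum ((quadraticChar F).ringHomComp (Int.castRingHom ℂ)) (ψ.mulShift a) =
      ∑ y : F, (quadraticChar F y : ℂ) * ψ (a * y) := rfl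
  have h3 := gaussSum_mulShift ((quadraticChar F).ringHomComp (Int.castRingHom ℂ)) ψ
    (Units.mk0 a ha)
  simp only [Units.val_mk0, MulChar.ringHomComp_apply, Int.coe_castRingHom] at h3
  rw [h1, ← h3, h2, ← mul_assoc, quadraticChar_cast_mul_self ha, one_mul]
  simp only [add_mul, one_mul, Finset.sum_add_distrib, hsum, add_zero]

theorem sum_addChar_half_mul_sq (hF : ringChar F ≠ 2) {ψ : AddChar F ℂ} (hψ : ψ ≠ 1) {a : F}
    (ha : a ≠ 0) :
    ∑ z : F, ψ (2⁻¹ * (a * z ^ 2)) = quadraticChar F a * gaussOne ψ := by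
  have h2 : (2 : F)⁻¹ ≠ 0 := inv_ne_zero (Ring.two_ne_zero hF)
  simp only [← mul_assoc]
  rw [gaussOne, sum_addChar_mul_sq hF hψ (mul_ne_zero h2 ha), sum_addChar_mul_sq hF hψ h2,
    quadraticChar_cast_mul]
  ring

theorem gaussOne_sq (hF : ringChar F ≠ 2) {ψ : AddChar F ℂ} (hψ : ψ ≠ 1) :
    gaussOne ψ ^ 2 = quadraticChar F (-1) * Fintype.card F := by
  have h2 : (2 : F)⁻¹ ≠ 0 := inv_ne_zero (Ring.two_ne_zero hF)
  have hχ : (quadraticChar F).ringHomComp (Int.castRingHom ℂ) ≠ 1 :=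
    (MulChar.ringHomComp_ne_one_iff (RingHom.injective_int _)).2 (quadraticChar_ne_one hF)
  rw [gaussOne, sum_addChar_mul_sq hF hψ h2, mul_pow,
    gaussSum_sq hχ ((quadraticChar_isQuadratic F).comp _) (AddChar.IsPrimitive.of_ne_one hψ), sq,
    quadraticChar_cast_mul_self h2, one_mul]
  rfl

/-- The Gauss sum of a nondegenerate symmetric bilinear form is `G₁ ^ r` times the quadratic
character of its discriminant. -/
theorem exists_basis_sum_addChar (hF : ringChar F ≠ 2) {ψ : AddChar F ℂ} (hψ : ψ ≠ 1)
    {W : Type*} [AddCommGroup W] [Module F W] [FiniteDimensional F W] [Fintype W]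
    (B : LinearMap.BilinForm F W) (hB : ∀ x y, B x y = B y x) (hnd : ∀ w, (∀ w', B w w' = 0) → w = 0)
    {r : ℕ} (hr : finrank F W = r) :
    ∃ v : Basis (Fin r) F W, (Matrix.of fun s t => B (v s) (v t)).det ≠ 0 ∧
      ∑ w : W, ψ (2⁻¹ * B w w) =
        gaussOne ψ ^ r * quadraticChar F (Matrix.of fun s t => B (v s) (v t)).det := by
  have : Invertible (2 : F) := invertibleOfNonzero (Ring.two_ne_zero hF)
  obtain ⟨v', hv'⟩ := LinearMap.BilinForm.exists_orthogonal_basis ⟨hB⟩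
  subst hr
  refine ⟨v', ?_⟩
  have ho : ∀ s t, s ≠ t → B (v' s) (v' t) = 0 := fun s t h => hv' h
  have hexp : ∀ (c : Fin (finrank F W) → F) t, B (∑ s, c s • v' s) (v' t) =
      c t * B (v' t) (v' t) := by
    intro c t
    rw [map_sum, LinearMap.sum_apply, Finset.sum_eq_single t]
    · simp
    · intro s _ hs; simp [ho s t hs]
    · simp
  have hd : (Matrix.of fun s t => B (v' s) (v' t)) = Matrix.diagonal fun s => B (v' s) (v' s) := by
    ext s t
    by_cases h : s = t
    · subst h; simp
    · simp [h, ho s t h]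
  have hne : ∀ s, B (v' s) (v' s) ≠ 0 := by
    intro s hs
    refine v'.ne_zero s (hnd _ fun w' => ?_)
    rw [← v'.sum_repr w', map_sum]
    refine Finset.sum_eq_zero fun t _ => ?_
    by_cases h : s = t
    · subst h; simp [hs]
    · simp [ho s t h]
  rw [hd, Matrix.det_diagonal]
  refine ⟨Finset.prod_ne_zero_iff.2 fun s _ => hne s, ?_⟩
  -- In orthogonal coordinates the form is diagonal, so the sum factors into one-variable Gauss
  -- sums.
  rw [← v'.equivFun.symm.toEquiv.sum_comp]
  have : ∀ c : Fin (finrank F W) → F, ψ (2⁻¹ * B (v'.equivFun.symm.toEquiv c)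
      (v'.equivFun.symm.toEquiv c)) = ∏ s, ψ (2⁻¹ * (B (v' s) (v' s) * c s ^ 2)) := by
    intro c
    have e : v'.equivFun.symm.toEquiv c = ∑ s, c s • v' s := v'.equivFun_symm_apply c
    rw [e]
    conv_lhs => rw [map_sum (B _)]
    rw [Finset.mul_sum]
    refine (map_prod ψ.toMonoidHom (fun s => Multiplicative.ofAdd
      (2⁻¹ * B (∑ t, c t • v' t) (c s • v' s))) Finset.univ).trans ?_
    refine Finset.prod_congr rfl fun s _ => ?_
    change ψ (2⁻¹ * B (∑ t, c t • v' t) (c s • v' s)) = _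
    rw [map_smul, hexp, smul_eq_mul]
    congr 1
    ring
  rw [Finset.sum_congr rfl fun c _ => this c]
  rw [← Fintype.piFinset_univ, Finset.sum_prod_piFinset Finset.univ
      (fun s z => ψ (2⁻¹ * (B (v' s) (v' s) * z ^ 2))),
    Finset.prod_congr rfl fun s _ => sum_addChar_half_mul_sq hF hψ (hne s)]
  rw [Finset.prod_mul_distrib, map_prod, Int.cast_prod]
  simp [mul_comm]

end GaussSums

/-! ### Lagrangian subspaces and common transversals. -/

section Transversals

variable {F V : Type*} [Field F] [AddCommGroup V] [Module F V]

theorem three_le_card [Fintype F] (hF : ringChar F ≠ 2) : 3 ≤ Fintype.card F := by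
  have h1 := FiniteField.odd_card_of_char_ne_two hF
  have h2 : 1 < Fintype.card F := Fintype.one_lt_card
  omega

/-- Over a field with at least three elements, a space is not the union of three proper
subspaces. -/
theorem exists_notMem_three [Fintype F] [FiniteDimensional F V] (hq : 3 ≤ Fintype.card F)
    {A B C : Submodule F V} (hA : A ≠ ⊤) (hB : B ≠ ⊤) (hC : C ≠ ⊤) :
    ∃ v, v ∉ A ∧ v ∉ B ∧ v ∉ C := by
  classical
  have : Finite V := Module.finite_of_finite F
  have := Fintype.ofFinite V
  have hcard : ∀ {D : Submodule F V}, D ≠ ⊤ →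
      3 * (Finset.univ.filter (· ∈ D)).card ≤ Fintype.card V := by
    intro D hD
    have h1 : finrank F D < finrank F V := Submodule.finrank_lt hD
    rw [← Fintype.card_subtype, Module.card_eq_pow_finrank (K := F) (V := V)]
    change 3 * Fintype.card D ≤ _
    rw [Module.card_eq_pow_finrank (K := F) (V := D)]
    calc 3 * Fintype.card F ^ finrank F D ≤ Fintype.card F * Fintype.card F ^ finrank F D := by
          gcongr
      _ = Fintype.card F ^ (finrank F D + 1) := by ring
      _ ≤ _ := Nat.pow_le_pow_right (by omega) h1
  -- Each subspace holds at most a third of the vectors, and `A`, `B` share `0`, so the three cannot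
  -- cover the space.
  by_contra! h
  have hcov : (Finset.univ : Finset V) ⊆ (Finset.univ.filter (· ∈ A) ∪ Finset.univ.filter (· ∈ B)) ∪
      Finset.univ.filter (· ∈ C) := by
    intro v _
    have := h v
    simp only [Finset.mem_union, Finset.mem_filter, Finset.mem_univ, true_and]
    tauto
  have h1 := (Finset.card_le_card hcov).trans (Finset.card_union_le _ _)
  have h2 := Finset.card_union_add_card_inter (Finset.univ.filter (· ∈ A))
    (Finset.univ.filter (· ∈ B))
  have h3 : 0 < (Finset.univ.filter (· ∈ A) ∩ Finset.univ.filter (· ∈ B)).card :=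
    Finset.card_pos.2 ⟨0, by simp⟩
  have := hcard hA
  have := hcard hB
  have := hcard hC
  rw [Finset.card_univ] at h1
  omega

variable {ω : LinearMap.BilinForm F V}

theorem IsLagrangian.finrank_eq [FiniteDimensional F V] (hAlt : ω.IsAlt) (hnd : ω.Nondegenerate)
    {n : ℕ} (hn : finrank F V = 2 * n) {L : Submodule F V} (hL : IsLagrangian ω L) :
    finrank F L = n := by
  have h := LinearMap.BilinForm.finrank_add_finrank_orthogonal hAlt.isRefl L
  rw [LinearMap.BilinForm.orthogonal_top_eq_bot hnd] at h
  rw [hL, inf_bot_eq, finrank_bot] at h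
  omega

theorem orthogonal_sup (A B : Submodule F V) :
    ω.orthogonal (A ⊔ B) = ω.orthogonal A ⊓ ω.orthogonal B := by
  refine le_antisymm (le_inf (LinearMap.BilinForm.orthogonal_le le_sup_left)
    (LinearMap.BilinForm.orthogonal_le le_sup_right)) fun x hx v hv => ?_
  obtain ⟨a, ha, b, hb, rfl⟩ := Submodule.mem_sup.1 hv
  have h1 : ω a x = 0 := hx.1 a ha
  have h2 : ω b x = 0 := hx.2 b hb
  change ω (a + b) x = 0
  simp [h1, h2]

theorem IsLagrangian.sup_eq_top [FiniteDimensional F V] (hAlt : ω.IsAlt) (hnd : ω.Nondegenerate)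
    {K L : Submodule F V} (hK : IsLagrangian ω K) (hL : IsLagrangian ω L) (h : K ⊓ L = ⊥) :
    K ⊔ L = ⊤ := by
  rw [← LinearMap.BilinForm.orthogonal_orthogonal hnd hAlt.isRefl (K ⊔ L), orthogonal_sup, hK, hL,
    h, LinearMap.BilinForm.orthogonal_bot]

theorem IsLagrangian.inf_eq_bot (hnd : ω.Nondegenerate) {K L : Submodule F V}
    (hK : IsLagrangian ω K) (hL : IsLagrangian ω L) (h : K ⊔ L = ⊤) : K ⊓ L = ⊥ := by
  rw [← LinearMap.BilinForm.orthogonal_top_eq_bot hnd, ← h, orthogonal_sup, hK, hL]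

theorem IsLagrangian.orthogonal_inf [FiniteDimensional F V] (hAlt : ω.IsAlt)
    (hnd : ω.Nondegenerate) {K L : Submodule F V} (hK : IsLagrangian ω K)
    (hL : IsLagrangian ω L) : ω.orthogonal (K ⊓ L) = K ⊔ L := by
  rw [← LinearMap.BilinForm.orthogonal_orthogonal hnd hAlt.isRefl (K ⊔ L), orthogonal_sup, hK, hL]

/-- Any three Lagrangians have a common transversal Lagrangian. -/
theorem exists_isLagrangian_sup_eq_top [Fintype F] [FiniteDimensional F V] (hF : ringChar F ≠ 2)
    (hAlt : ω.IsAlt) (hnd : ω.Nondegenerate) {n : ℕ} (hn : finrank F V = 2 * n)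
    (L : Fin 3 → Submodule F V) (hL : ∀ j, IsLagrangian ω (L j)) :
    ∃ K, IsLagrangian ω K ∧ ∀ j, K ⊔ L j = ⊤ := by
  -- A maximal isotropic subspace among those meeting every `L j` trivially turns out to be
  -- Lagrangian.
  let S : Set (Submodule F V) := {K | K ≤ ω.orthogonal K ∧ ∀ j, K ⊓ L j = ⊥}
  obtain ⟨K, ⟨hK, hKL⟩, hmax⟩ := wellFounded_gt.has_min S ⟨⊥, bot_le, fun j => bot_inf_eq _⟩
  suffices h : IsLagrangian ω K from ⟨K, h, fun j => h.sup_eq_top hAlt hnd (hL j) (hKL j)⟩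
  by_contra hne
  have hlt : K < ω.orthogonal K := lt_of_le_of_ne hK (Ne.symm hne)
  have hdim := LinearMap.BilinForm.finrank_orthogonal hnd K
  have hlt' := Submodule.finrank_lt_finrank_of_lt hlt
  -- If `K^⊥ ≤ K + L j`, passing to complements gives `K^⊥ ∩ L j ≤ K`, hence `K^⊥ ∩ L j = 0` and
  -- `dim K^⊥ ≤ n`. But `K < K^⊥` forces `dim K^⊥ > n`.
  have hproper : ∀ j, (K ⊔ L j).submoduleOf (ω.orthogonal K) ≠ ⊤ := by
    intro j hj
    have h1 : ω.orthogonal K ≤ K ⊔ L j := Submodule.submoduleOf_eq_top.1 hj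
    have h2 := LinearMap.BilinForm.orthogonal_le (B := ω) h1
    rw [orthogonal_sup, LinearMap.BilinForm.orthogonal_orthogonal hnd hAlt.isRefl, hL j] at h2
    have h3 : Disjoint (ω.orthogonal K) (L j) := by
      rw [disjoint_iff, eq_bot_iff, ← hKL j]
      exact le_inf h2 inf_le_right
    have h4 := Submodule.finrank_add_finrank_le_of_disjoint h3
    rw [(hL j).finrank_eq hAlt hnd hn] at h4
    omega
  obtain ⟨⟨v, hv⟩, h0, h1, h2⟩ := exists_notMem_three (three_le_card hF)
    (hproper 0) (hproper 1) (hproper 2)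
  have hvL : ∀ j, v ∉ K ⊔ L j := by
    intro j
    fin_cases j
    · exact h0
    · exact h1
    · exact h2
  -- A vector of `K^⊥` outside every `K + L j` enlarges `K` within `S`, against maximality.
  refine hmax (K ⊔ Submodule.span F {v}) ⟨?_, fun j => ?_⟩ ?_
  · rw [orthogonal_sup]
    have hspan : Submodule.span F {v} ≤ ω.orthogonal (Submodule.span F {v}) := by
      rw [Submodule.span_singleton_le_iff_mem]
      intro x hx
      obtain ⟨c, rfl⟩ := Submodule.mem_span_singleton.1 hx
      change ω (c • v) v = 0
      simp [hAlt v]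
    have hvK : Submodule.span F {v} ≤ ω.orthogonal K := by
      rwa [Submodule.span_singleton_le_iff_mem]
    refine sup_le (le_inf hK ?_) (le_inf hvK hspan)
    exact (LinearMap.BilinForm.le_orthogonal_orthogonal hAlt.isRefl).trans
      (LinearMap.BilinForm.orthogonal_le hvK)
  · rw [eq_bot_iff]
    rintro x ⟨hx, hxL⟩
    obtain ⟨k, hk, y, hy, rfl⟩ := Submodule.mem_sup.1 hx
    obtain ⟨c, rfl⟩ := Submodule.mem_span_singleton.1 hy
    by_cases hc : c = 0
    · subst hc
      rw [← hKL j]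
      simp only [zero_smul, add_zero] at hxL ⊢
      exact ⟨hk, hxL⟩
    · refine absurd ?_ (hvL j)
      have : v = c⁻¹ • (-k + (k + c • v)) := by
        rw [neg_add_cancel_left, smul_smul, inv_mul_cancel₀ hc, one_smul]
      rw [this]
      exact Submodule.smul_mem _ _ (Submodule.add_mem_sup (K.neg_mem hk) hxL)
  · refine lt_of_le_of_ne le_sup_left fun h => hvL 0 ?_
    refine Submodule.mem_sup_left ?_
    rw [h]
    exact Submodule.mem_sup_right (Submodule.mem_span_singleton_self v)

end Transversals

/-! ### The quadratic form on `K ∩ (M + L)` and adapted families. -/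

section AdaptedBases

variable {F V : Type*} [Field F] [AddCommGroup V] [Module F V] [FiniteDimensional F V]
  {ω : LinearMap.BilinForm F V}

/-- Since `K + (M + L) = V` and `dim (M + L) = n + r`, the intersection has dimension `n + (n + r) -
2n`. -/
theorem finrank_submoduleOf_sup (hAlt : ω.IsAlt) (hnd : ω.Nondegenerate) {n : ℕ}
    (hn : finrank F V = 2 * n) {K L M : Submodule F V} (hK : IsLagrangian ω K)
    (hL : IsLagrangian ω L) (hM : IsLagrangian ω M) (hKL : K ⊔ L = ⊤) {i r : ℕ}
    (hi : finrank F ↥(M ⊓ L) = i) (hir : i + r = n) :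
    finrank F ((M ⊔ L).submoduleOf K) = r := by
  have h1 : finrank F ((M ⊔ L).submoduleOf K) = finrank F ↥(K ⊓ (M ⊔ L)) := by
    rw [← Submodule.finrank_map_subtype_eq, Submodule.submoduleOf, Submodule.map_comap_subtype]
  have h2 := Submodule.finrank_sup_add_finrank_inf_eq K (M ⊔ L)
  have h3 : K ⊔ (M ⊔ L) = ⊤ := by
    rw [eq_top_iff, ← hKL]
    exact sup_le_sup_left le_sup_right _
  have h4 := Submodule.finrank_sup_add_finrank_inf_eq M L
  rw [h3, finrank_top, hK.finrank_eq hAlt hnd hn] at h2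
  rw [hM.finrank_eq hAlt hnd hn, hL.finrank_eq hAlt hnd hn] at h4
  omega

/-- A linear choice of decompositions of the vectors of `K ∩ (M + L)`. -/
theorem exists_decomposition (K L M : Submodule F V) :
    ∃ (lam : (M ⊔ L).submoduleOf K →ₗ[F] L) (mu : (M ⊔ L).submoduleOf K →ₗ[F] M),
      ∀ w : (M ⊔ L).submoduleOf K, ((w : K) : V) = lam w + mu w := by
  let φ : L × M →ₗ[F] V := L.subtype.coprod M.subtype
  have hφ : LinearMap.range φ = M ⊔ L := by
    rw [LinearMap.range_coprod, Submodule.range_subtype, Submodule.range_subtype, sup_comm]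
  let g : (M ⊔ L).submoduleOf K →ₗ[F] LinearMap.range φ :=
    LinearMap.codRestrict _ (K.subtype ∘ₗ Submodule.subtype _) fun w => by
      rw [hφ]; exact w.2
  obtain ⟨s, hs⟩ := Module.projective_lifting_property φ.rangeRestrict g φ.surjective_rangeRestrict
  refine ⟨LinearMap.fst F L M ∘ₗ s, LinearMap.snd F L M ∘ₗ s, fun w => ?_⟩
  exact congrArg Subtype.val (LinearMap.congr_fun hs w).symm

/-- Vectors of `K` dual to a basis of a subspace of `L`. -/
theorem exists_dual_family (hnd : ω.Nondegenerate) {K L : Submodule F V}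
    (hL : IsLagrangian ω L) (hKL : K ⊔ L = ⊤) {I : Submodule F V} (hI : I ≤ L) {i : ℕ}
    (e : Basis (Fin i) F I) :
    ∃ k : Fin i → K, ∀ a b, ω (e a) (k b) = if a = b then 1 else 0 := by
  suffices h : ∀ b, ∃ k : K, ∀ a, ω (e a) k = if a = b then 1 else 0 by
    choose k hk using h
    exact ⟨k, fun a b => hk b a⟩
  intro b
  obtain ⟨g, hg⟩ := LinearMap.exists_extend (e.coord b)
  have hfl := LinearMap.BilinForm.Nondegenerate.flip hnd
  obtain ⟨v, hv⟩ := (ω.flip.toDual hfl).surjective g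
  have hv' : ∀ a, ω (e a) v = if a = b then 1 else 0 := by
    intro a
    have h1 : ω (e a) v = g (e a) := by
      rw [← hv, LinearMap.BilinForm.toDual_def]; rfl
    rw [h1, ← Submodule.subtype_apply, ← LinearMap.comp_apply, hg, Basis.coord_apply,
      Basis.repr_self, Finsupp.single_apply]
  -- Dropping the `L`-component of `v` changes no pairing with `e a ∈ L`.
  have hvt : v ∈ K ⊔ L := hKL ▸ Submodule.mem_top
  obtain ⟨k, hk, l, hl, rfl⟩ := Submodule.mem_sup.1 hvt
  refine ⟨⟨k, hk⟩, fun a => ?_⟩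
  rw [← hv' a, map_add, hL.apply_eq_zero (hI (e a).2) hl, add_zero]

/-- Families adapted to a pair of Lagrangians and a common transversal, together with the Gauss
sum of the quadratic form that they define on `K ∩ (M + L)`. -/
theorem exists_adapted_families [Fintype F] [DecidableEq F] (hF : ringChar F ≠ 2)
    (hAlt : ω.IsAlt) (hnd : ω.Nondegenerate) {n : ℕ} (hn : finrank F V = 2 * n)
    {ψ : AddChar F ℂ} (hψ : ψ ≠ 1) {K L M : Submodule F V} (hK : IsLagrangian ω K)
    (hL : IsLagrangian ω L) (hM : IsLagrangian ω M) (hKL : K ⊔ L = ⊤) (hKM : K ⊔ M = ⊤)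
    [Fintype ((M ⊔ L).submoduleOf K)] {i r : ℕ}
    (hi : finrank F ↥(M ⊓ L) = i) (hir : i + r = n)
    (lam : (M ⊔ L).submoduleOf K →ₗ[F] L) (mu : (M ⊔ L).submoduleOf K →ₗ[F] M)
    (hdec : ∀ w : (M ⊔ L).submoduleOf K, ((w : K) : V) = lam w + mu w) :
    ∃ (e : Basis (Fin i) F ↥(M ⊓ L)) (k : Fin i → K) (w : Fin r → K) (l : Fin r → L)
      (m : Fin r → M),
      (∀ a b, ω (e a) (k b) = if a = b then 1 else 0) ∧ (∀ a s, ω (e a) (w s) = 0) ∧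
      (∀ s, (w s : V) = l s + m s) ∧ (Matrix.of fun s t => ω (l s) (m t)).det ≠ 0 ∧
      ∑ w, ψ (2⁻¹ * -ω (lam w) (mu w)) =
        gaussOne ψ ^ r * quadraticChar F ((-1) ^ r * (Matrix.of fun s t => ω (l s) (m t)).det) := by
  let B : LinearMap.BilinForm F ((M ⊔ L).submoduleOf K) :=
    -(ω.compl₁₂ (L.subtype ∘ₗ lam) (M.subtype ∘ₗ mu))
  have hBapp : ∀ w w', B w w' = -ω (lam w) (mu w') := fun w w' => rfl
  have hBK : ∀ w w', B w w' = -ω (lam w) (w' : K) := fun w w' => by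
    rw [hBapp, hdec w', map_add, hL.apply_eq_zero (lam w).2 (lam w').2, zero_add]
  -- Symmetry comes from expanding `ω(w, w') = 0` on the isotropic `K`.
  have hsymm : ∀ w w', B w w' = B w' w := fun w w' => by
    have h := hK.apply_eq_zero (w : K).2 (w' : K).2
    rw [hdec w, hdec w'] at h
    simp only [map_add, LinearMap.add_apply, hL.apply_eq_zero (lam w).2 (lam w').2,
      hM.apply_eq_zero (mu w).2 (mu w').2, zero_add, add_zero] at h
    rw [hBapp, hBapp]
    linear_combination -h - hAlt.neg_eq (mu w : V) (lam w')
  have hKL' := hK.inf_eq_bot hnd hL hKL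
  have hKM' := hK.inf_eq_bot hnd hM hKM
  -- For `w` in the radical, `λ(w)` is orthogonal to `K ∩ (M + L)`, so it lies in `K + M ∩ L`. Its
  -- `K`-part is in `K ∩ L = 0`, hence `λ(w) ∈ M` and `w ∈ K ∩ M = 0`.
  have hBnd : ∀ w, (∀ w', B w w' = 0) → w = 0 := by
    intro w hw
    have h1 : (lam w : V) ∈ ω.orthogonal (K ⊓ (M ⊔ L)) := by
      rintro x ⟨hxK, hx⟩
      have h2 := hw ⟨⟨x, hxK⟩, hx⟩
      rw [hBK, neg_eq_zero] at h2
      exact hAlt.isRefl _ _ h2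
    have hperp : ω.orthogonal (K ⊓ (M ⊔ L)) = K ⊔ M ⊓ L := by
      rw [← LinearMap.BilinForm.orthogonal_orthogonal hnd hAlt.isRefl (K ⊔ M ⊓ L), orthogonal_sup,
        hK, hM.orthogonal_inf hAlt hnd hL]
    rw [hperp] at h1
    obtain ⟨k, hk, y, hy, hky⟩ := Submodule.mem_sup.1 h1
    have hk0 : k = 0 := by
      rw [← Submodule.mem_bot F, ← hKL']
      refine ⟨hk, ?_⟩
      rw [eq_sub_of_add_eq hky]
      exact L.sub_mem (lam w).2 hy.2
    have h3 : ((w : K) : V) ∈ K ⊓ M := by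
      refine ⟨(w : K).2, ?_⟩
      rw [hdec w, ← hky, hk0, zero_add]
      exact M.add_mem hy.1 (mu w).2
    rw [hKM', Submodule.mem_bot] at h3
    exact Subtype.ext (Subtype.ext h3)
  obtain ⟨v, hv, hsum⟩ := exists_basis_sum_addChar hF hψ B hsymm hBnd
    (finrank_submoduleOf_sup hAlt hnd hn hK hL hM hKL hi hir)
  have hdet : (Matrix.of fun s t => B (v s) (v t)).det =
      (-1) ^ r * (Matrix.of fun s t => ω (lam (v s)) (mu (v t))).det := by
    have : (Matrix.of fun s t => B (v s) (v t)) =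
        -(Matrix.of fun s t => ω (lam (v s)) (mu (v t))) := rfl
    rw [this, Matrix.det_neg, Fintype.card_fin]
  let e : Basis (Fin i) F ↥(M ⊓ L) := finBasisOfFinrankEq F _ hi
  obtain ⟨k, hk⟩ := exists_dual_family hnd hL hKL inf_le_right e
  refine ⟨e, k, fun s => v s, fun s => lam (v s), fun s => mu (v s), hk, fun a s => ?_,
    fun s => hdec _, ?_, ?_⟩
  · rw [hdec, map_add, hL.apply_eq_zero (e a).2.2 (lam _).2,
      hM.apply_eq_zero (e a).2.1 (mu _).2, add_zero]
  · rw [hdet] at hv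
    exact right_ne_zero_of_mul hv
  · rw [← hdet]
    exact hsum

end AdaptedBases

/-! ### Averaging morphisms and their composition. -/

section Averages

variable {F V : Type*} [Field F] [AddCommGroup V] [Module F V]
  {ω : LinearMap.BilinForm F V} {n : ℕ} {ψ : AddChar F ℂ}

theorem ofVec_add (v w : V) :
    ofVec ω (v + w) = ofCen ω (2⁻¹ * -ω v w) * (ofVec ω v * ofVec ω w) := by
  ext <;> simp [ofVec, ofCen]

theorem ofVec_mul_ofVec_comm (h2 : (2 : F) ≠ 0) (hAlt : ω.IsAlt) (v w : V) :
    ofVec ω v * ofVec ω w = ofCen ω (ω v w) * (ofVec ω w * ofVec ω v) := by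
  ext
  · simp [ofVec, ofCen, add_comm]
  · simp only [ofVec, ofCen, mul_cen, ← hAlt.neg_eq v w]
    field_simp
    simp
    ring

variable [Fintype F] [FiniteDimensional F V]

theorem fullAverage_apply (M L : OLag ω n) [Fintype M.carrier] (f : model ω ψ L.carrier)
    (h : Heisenberg ω) :
    (fullAverage ψ M L f).1 h = ∑ m : M.carrier, f.1 (ofVec ω m * h) := by
  simp only [fullAverage]
  exact Finset.sum_congr (by ext; simp) fun _ _ => rfl

theorem average_apply (M L : OLag ω n)
    [Fintype (M.carrier ⧸ (inter M L).submoduleOf M.carrier)] (f : model ω ψ L.carrier)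
    (h : Heisenberg ω) :
    (average ψ M L f).1 h = ∑ q : M.carrier ⧸ (inter M L).submoduleOf M.carrier,
      f.1 (ofVec ω (Quotient.out q : M.carrier) * h) := by
  simp only [average]
  exact Finset.sum_congr (by ext; simp) fun _ _ => rfl

theorem fullAverage_rep (M L : OLag ω n) (h : Heisenberg ω) (f : model ω ψ L.carrier) :
    fullAverage ψ M L (rep ω ψ L.carrier h f) = rep ω ψ M.carrier h (fullAverage ψ M L f) := by
  have : Finite V := Module.finite_of_finite F
  have := Fintype.ofFinite M.carrier
  ext h'
  change _ = (fullAverage ψ M L f).1 (h' * h)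
  rw [fullAverage_apply, fullAverage_apply]
  refine Finset.sum_congr rfl fun m _ => ?_
  change f.1 (ofVec ω m * h' * h) = _
  rw [mul_assoc]

/-- The summand is constant on cosets of `I` in `M`, each of size `q ^ dim I`. -/
theorem fullAverage_eq_smul_average (M L : OLag ω n) :
    fullAverage ψ M L =
      ((Fintype.card F : ℂ) ^ finrank F (inter M L)) • average ψ M L := by
  have : Finite V := Module.finite_of_finite F
  have := Fintype.ofFinite M.carrier
  have : Finite (M.carrier ⧸ (inter M L).submoduleOf M.carrier) := Quotient.finite _
  have := Fintype.ofFinite (M.carrier ⧸ (inter M L).submoduleOf M.carrier)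
  have := Fintype.ofFinite ((inter M L).submoduleOf M.carrier)
  ext f h
  change _ = (Fintype.card F : ℂ) ^ finrank F (inter M L) * (average ψ M L f).1 h
  rw [fullAverage_apply, average_apply]
  let N := (inter M L).submoduleOf M.carrier
  have hmk : ∀ (q : M.carrier ⧸ N) (x : N),
      (Submodule.Quotient.mk ((Quotient.out q : M.carrier) + x) : M.carrier ⧸ N) = q := by
    intro q x
    rw [Submodule.Quotient.mk_add, (Submodule.Quotient.mk_eq_zero N).2 x.2, add_zero]
    exact Quotient.out_eq q
  have hbij : Function.Bijective
      (fun p : (M.carrier ⧸ N) × N => (Quotient.out p.1 : M.carrier) + p.2) := by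
    constructor
    · rintro ⟨q, x⟩ ⟨q', x'⟩ h
      obtain rfl : q = q' := by rw [← hmk q x, ← hmk q' x']; exact congrArg _ h
      exact Prod.ext rfl (Subtype.ext (add_left_cancel h))
    · intro m
      refine ⟨(Submodule.Quotient.mk m, ⟨m - Quotient.out (Submodule.Quotient.mk m : M.carrier ⧸ N),
        ?_⟩), add_sub_cancel _ _⟩
      rw [← Submodule.Quotient.mk_eq_zero N, Submodule.Quotient.mk_sub, sub_eq_zero]
      exact (Quotient.out_eq (Submodule.Quotient.mk m : M.carrier ⧸ N)).symm
  have hcard : (Fintype.card N : ℂ) = (Fintype.card F : ℂ) ^ finrank F (inter M L) := by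
    rw [Module.card_eq_pow_finrank (K := F) (V := N),
      (Submodule.submoduleOfEquivOfLe (inter_le_left M L)).finrank_eq, Nat.cast_pow]
  rw [← Fintype.sum_bijective _ hbij _ _ fun p => rfl, Fintype.sum_prod_type, ← hcard,
    Finset.mul_sum]
  refine Finset.sum_congr rfl fun q _ => ?_
  rw [Finset.sum_congr rfl fun x _ => model_apply_congr (m' := Quotient.out q) f
    ((hmk q x).trans (Quotient.out_eq q).symm) h]
  simp [N]

/-- The scalar is the Gauss sum over `K ∩ (M + L)`; the other `k ∈ K` contribute nothing. -/
theorem fullAverage_comp_fullAverage (h2 : (2 : F) ≠ 0) (hAlt : ω.IsAlt) (hnd : ω.Nondegenerate)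
    (hψ : ψ ≠ 1) (M K L : OLag ω n)
    [Fintype ((M.carrier ⊔ L.carrier).submoduleOf K.carrier)]
    (lam : (M.carrier ⊔ L.carrier).submoduleOf K.carrier →ₗ[F] L.carrier)
    (mu : (M.carrier ⊔ L.carrier).submoduleOf K.carrier →ₗ[F] M.carrier)
    (hdec : ∀ w : (M.carrier ⊔ L.carrier).submoduleOf K.carrier,
      ((w : K.carrier) : V) = lam w + mu w) :
    fullAverage ψ M K ∘ₗ fullAverage ψ K L =
      (∑ w, ψ (2⁻¹ * -ω (lam w) (mu w))) • fullAverage ψ M L := by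
  classical
  have : Finite V := Module.finite_of_finite F
  have := Fintype.ofFinite M.carrier
  have := Fintype.ofFinite K.carrier
  ext f h
  change (fullAverage ψ M K (fullAverage ψ K L f)).1 h = _ * (fullAverage ψ M L f).1 h
  simp only [fullAverage_apply]
  rw [Finset.sum_comm]
  -- Such a `k` pairs nontrivially with some `y ∈ I`. Translating `m` by `t • y` preserves the sum;
  -- commuting `t • y` past `k` and absorbing it by `L`-invariance multiplies the sum by a value of
  -- `ψ` other than `1`.
  have hzero : ∀ k : K.carrier, k ∉ (M.carrier ⊔ L.carrier).submoduleOf K.carrier →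
      ∑ m : M.carrier, f.1 (ofVec ω k * (ofVec ω m * h)) = 0 := by
    intro k hk
    have hk' : (k : V) ∉ ω.orthogonal (M.carrier ⊓ L.carrier) := by
      rwa [M.isLagrangian.orthogonal_inf hAlt hnd L.isLagrangian]
    simp only [LinearMap.BilinForm.mem_orthogonal_iff, not_forall] at hk'
    obtain ⟨y, hy, hyk⟩ := hk'
    have hky : ω k y ≠ 0 := fun h0 => hyk (hAlt.isRefl _ _ h0)
    obtain ⟨t, ht⟩ := AddChar.ne_one_iff.1 (AddChar.IsPrimitive.of_ne_one hψ hky)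
    have hty : t • y ∈ M.carrier ⊓ L.carrier := Submodule.smul_mem _ _ hy
    have key : ∑ m : M.carrier, f.1 (ofVec ω k * (ofVec ω m * h)) =
        ψ (ω k y * t) * ∑ m : M.carrier, f.1 (ofVec ω k * (ofVec ω m * h)) := by
      rw [Finset.mul_sum, 
        ← Fintype.sum_equiv (Equiv.addLeft (⟨t • y, hty.1⟩ : M.carrier)) _ _ fun m => rfl]
      refine Finset.sum_congr rfl fun m _ => ?_
      have e1 : ofVec ω ((Equiv.addLeft (⟨t • y, hty.1⟩ : M.carrier) m : M.carrier) : V) =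
          ofVec ω (t • y) * ofVec ω m := by
        rw [ofVec_mul_ofVec (M.isLagrangian.apply_eq_zero hty.1 m.2)]; rfl
      rw [e1, mul_assoc (ofVec ω (t • y)), ← mul_assoc (ofVec ω (k : V)),
        ofVec_mul_ofVec_comm h2 hAlt, mul_assoc, f.2.1, mul_assoc, f.2.2 _ hty.2, map_smul,
        smul_eq_mul, mul_comm t]
    have hne : 1 - ψ (ω k y * t) ≠ 0 := fun h0 => ht (sub_eq_zero.1 h0).symm
    refine (mul_eq_zero.1 (?_ : (1 - ψ (ω k y * t)) * _ = 0)).resolve_left hne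
    rw [sub_mul, one_mul, ← key, sub_self]
  -- Splitting `λ + μ` in the Heisenberg group costs a central factor; then `λ` is absorbed by
  -- `L`-invariance and `μ` by a translation in `M`.
  have hmem : ∀ w : (M.carrier ⊔ L.carrier).submoduleOf K.carrier,
      ∑ m : M.carrier, f.1 (ofVec ω ((w : K.carrier) : V) * (ofVec ω m * h)) =
        ψ (2⁻¹ * -ω (lam w) (mu w)) * ∑ m : M.carrier, f.1 (ofVec ω m * h) := by
    intro w
    rw [Finset.mul_sum]
    refine Eq.trans ?_ (Fintype.sum_equiv (Equiv.addLeft (mu w)) (fun m : M.carrier =>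
      ψ (2⁻¹ * -ω (lam w) (mu w)) * f.1 (ofVec ω ((Equiv.addLeft (mu w) m : M.carrier) : V) * h))
      _ fun m => rfl)
    refine Finset.sum_congr rfl fun m _ => ?_
    have e1 : ofVec ω ((Equiv.addLeft (mu w) m : M.carrier) : V) =
        ofVec ω (mu w : V) * ofVec ω m := by
      rw [ofVec_mul_ofVec (M.isLagrangian.apply_eq_zero (mu w).2 m.2)]; rfl
    rw [hdec w, ofVec_add, mul_assoc, f.2.1, mul_assoc, f.2.2 _ (lam w).2, e1, mul_assoc]
  rw [Finset.sum_mul, ← Finset.sum_congr rfl fun w _ => hmem w]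
  rw [← Finset.sum_filter_add_sum_filter_not Finset.univ
      (· ∈ (M.carrier ⊔ L.carrier).submoduleOf K.carrier),
    Finset.sum_eq_zero (s := Finset.univ.filter fun k => ¬ _)
      fun k hk => hzero k (Finset.mem_filter.1 hk).2, add_zero]
  exact Finset.sum_subtype _ (by simp) _

theorem average_self (L : OLag ω n) : average ψ L L = LinearMap.id := by
  have : Finite V := Module.finite_of_finite F
  have : Finite (L.carrier ⧸ (inter L L).submoduleOf L.carrier) := Quotient.finite _
  have := Fintype.ofFinite (L.carrier ⧸ (inter L L).submoduleOf L.carrier)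
  have : Subsingleton (L.carrier ⧸ (inter L L).submoduleOf L.carrier) := by
    rw [Submodule.Quotient.subsingleton_iff, inter, inf_idem, Submodule.submoduleOf_self]
  ext f h
  change (average ψ L L f).1 h = f.1 h
  rw [average_apply, Fintype.sum_subsingleton _ 0]
  exact f.2.2 _ (Quotient.out _ : L.carrier).2 h

end Averages

/-! ### Top exterior powers and splittings of orientations. -/

section ExteriorPowers

/-- The concatenation of families of lengths `i` and `r`, indexed by `Fin n` with `n = i + r`. -/
def concat {X : Type*} {i r n : ℕ} (h : i + r = n) (u : Fin i → X) (v : Fin r → X) : Fin n → X :=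
  Sum.elim u v ∘ (finSumFinEquiv.trans (finCongr h)).symm

theorem concat_rfl {X : Type*} {i r : ℕ} (u : Fin i → X) (v : Fin r → X) :
    concat rfl u v = Fin.append u v := by
  ext j
  refine Fin.addCases (fun a => ?_) (fun a => ?_) j <;> simp [concat]

variable {F X : Type*} [Field F] [AddCommGroup X] [Module F X]

theorem eq_of_smul_eq_smul_right {a b : F} {x : X} (h : a • x = b • x) (hx : x ≠ 0) : a = b :=
  smul_left_injective F hx h

theorem ιMulti_concat {i r n : ℕ} (h : i + r = n) (u : Fin i → X) (v : Fin r → X) :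
    ExteriorAlgebra.ιMulti F n (concat h u v) =
      ExteriorAlgebra.ιMulti F i u * ExteriorAlgebra.ιMulti F r v := by
  subst h
  rw [concat_rfl, ExteriorAlgebra.ιMulti_mul_ιMulti]

theorem linearIndependent_concat {i r n : ℕ} (h : i + r = n) {u : Fin i → X} {v : Fin r → X} :
    LinearIndependent F (concat h u v) ↔ LinearIndependent F (Sum.elim u v) :=
  linearIndependent_equiv _

theorem det_concat {Y : Type*} [AddCommGroup Y] [Module F Y] (B : X →ₗ[F] Y →ₗ[F] F) {i r n : ℕ}
    (h : i + r = n) (u : Fin i → X) (v : Fin r → X) (u' : Fin i → Y) (v' : Fin r → Y) :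
    (Matrix.of fun a b => B (concat h u v a) (concat h u' v' b)).det =
      (Matrix.fromBlocks (Matrix.of fun a b => B (u a) (u' b)) (Matrix.of fun a b => B (u a) (v' b))
        (Matrix.of fun a b => B (v a) (u' b)) (Matrix.of fun a b => B (v a) (v' b))).det := by
  rw [← Matrix.det_submatrix_equiv_self (finSumFinEquiv.trans (finCongr h)).symm]
  congr 1
  ext a b
  simp only [concat, Matrix.of_apply, Matrix.submatrix_apply, Function.comp_apply]
  generalize (finSumFinEquiv.trans (finCongr h)).symm a = a'
  generalize (finSumFinEquiv.trans (finCongr h)).symm b = b'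
  rcases a' with a' | a' <;> rcases b' with b' | b' <;> rfl

theorem linearIndependent_left_of_det_ne_zero {Y : Type*} [AddCommGroup Y] [Module F Y]
    (B : X →ₗ[F] Y →ₗ[F] F) {n : ℕ} {x : Fin n → X} {y : Fin n → Y}
    (h : (Matrix.of fun a b => B (x a) (y b)).det ≠ 0) : LinearIndependent F x := by
  rw [Fintype.linearIndependent_iff]
  intro c hc
  refine congrFun (Matrix.eq_zero_of_vecMul_eq_zero h ?_)
  ext b
  have := congrArg (fun z => B z (y b)) hc
  simpa [Matrix.vecMul, dotProduct] using this

theorem linearIndependent_right_of_det_ne_zero {Y : Type*} [AddCommGroup Y] [Module F Y]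
    (B : X →ₗ[F] Y →ₗ[F] F) {n : ℕ} {x : Fin n → X} {y : Fin n → Y}
    (h : (Matrix.of fun a b => B (x a) (y b)).det ≠ 0) : LinearIndependent F y := by
  refine linearIndependent_left_of_det_ne_zero B.flip (y := x) ?_
  rwa [← Matrix.det_transpose] at h

theorem ιMulti_basis_ne_zero {r : ℕ} (b : Basis (Fin r) F X) :
    exteriorPower.ιMulti F r b ≠ 0 := by
  intro h
  have := exteriorPower.alternatingMapLinearEquiv_apply_ιMulti b.det b
  rw [h, map_zero, b.det_self] at this
  exact zero_ne_one this

theorem exists_eq_smul_ιMulti_basis {r : ℕ} (b : Basis (Fin r) F X) (y : ⋀[F]^r X) :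
    ∃ c : F, y = c • exteriorPower.ιMulti F r b := by
  have hy : y ∈ Submodule.span F (Set.range (exteriorPower.ιMulti F r (M := X))) := by
    rw [exteriorPower.ιMulti_span]; trivial
  -- An alternating map is determined by its values on permutations of a basis, so the universal one
  -- is `b.det` times its value at `b`.
  have hdet : exteriorPower.ιMulti F r =
      (LinearMap.toSpanSingleton F _ (exteriorPower.ιMulti F r b)).compAlternatingMap b.det := by
    refine Basis.ext_alternating b fun v hv => ?_
    let σ : Equiv.Perm (Fin r) := Equiv.ofBijective v (Finite.injective_iff_bijective.1 hv)
    change exteriorPower.ιMulti F r (b ∘ σ) = b.det (b ∘ σ) • exteriorPower.ιMulti F r b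
    rw [AlternatingMap.map_perm, AlternatingMap.map_perm, b.det_self, Units.smul_def,
      Units.smul_def, smul_assoc, one_smul]
  induction hy using Submodule.span_induction with
  | mem x hx =>
    obtain ⟨v, rfl⟩ := hx
    exact ⟨b.det v, congrArg (fun f : X [⋀^Fin r]→ₗ[F] _ => f v) hdet⟩
  | zero => exact ⟨0, (zero_smul _ _).symm⟩
  | add x y _ _ hx hy =>
    obtain ⟨c, rfl⟩ := hx
    obtain ⟨d, rfl⟩ := hy
    exact ⟨c + d, (add_smul _ _ _).symm⟩
  | smul a x _ hx =>
    obtain ⟨c, rfl⟩ := hx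
    exact ⟨a * c, (mul_smul _ _ _).symm⟩

/-- Factors are replaced one at a time from the left. By anticommutation `U * ι (p a)` is again
killed by `N`, so the induction must run over all such `U`. -/
theorem mul_prod_ι_eq {N : Submodule F X} {p : X → X} (hp : ∀ x, x - p x ∈ N) (l : List X) :
    ∀ U : ExteriorAlgebra F X, (∀ x ∈ N, U * ExteriorAlgebra.ι F x = 0) →
      U * (l.map (ExteriorAlgebra.ι F)).prod =
        U * (l.map fun x => ExteriorAlgebra.ι F (p x)).prod := by
  induction l with
  | nil => intro U _; rfl
  | cons a l ih =>
    intro U hU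
    have h1 : U * ExteriorAlgebra.ι F a = U * ExteriorAlgebra.ι F (p a) := by
      rw [← sub_eq_zero, ← mul_sub, ← map_sub, hU _ (hp a)]
    simp only [List.map_cons, List.prod_cons, ← mul_assoc]
    rw [h1]
    refine ih _ fun x hx => ?_
    have h2 := ExteriorAlgebra.ι_add_mul_swap (R := F) (p a) x
    rw [mul_assoc, eq_neg_of_add_eq_zero_left h2, mul_neg, ← mul_assoc, hU x hx, zero_mul, neg_zero]

/-- If `U` is killed by `N`, then the product of `U` and `y` depends only on `y` modulo `N`. -/
theorem mul_eq_of_map_mkQ_eq {N : Submodule F X} {U : ExteriorAlgebra F X}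
    (hU : ∀ x ∈ N, U * ExteriorAlgebra.ι F x = 0) {r : ℕ} {y y' : ⋀[F]^r X}
    (h : exteriorPower.map r N.mkQ y = exteriorPower.map r N.mkQ y') :
    U * (y : ExteriorAlgebra F X) = U * y' := by
  -- Projecting every vector along `N` by a section of the quotient does not alter the product with
  -- `U`, and the projected element depends only on the class modulo `N`.
  obtain ⟨s, hs⟩ := N.mkQ.exists_rightInverse_of_surjective (Submodule.range_mkQ N)
  have hp : ∀ x, x - (s ∘ₗ N.mkQ) x ∈ N := by
    intro x
    rw [← Submodule.Quotient.mk_eq_zero, Submodule.Quotient.mk_sub, sub_eq_zero]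
    exact (LinearMap.congr_fun hs (N.mkQ x)).symm
  have key : ∀ z : ⋀[F]^r X, U * (z : ExteriorAlgebra F X) =
      U * (exteriorPower.map r (s ∘ₗ N.mkQ) z : ⋀[F]^r X) := by
    intro z
    have hz : z ∈ Submodule.span F (Set.range (exteriorPower.ιMulti F r (M := X))) := by
      rw [exteriorPower.ιMulti_span]; trivial
    induction hz using Submodule.span_induction with
    | mem x hx =>
      obtain ⟨v, rfl⟩ := hx
      rw [exteriorPower.map_apply_ιMulti, exteriorPower.ιMulti_apply_coe,
        exteriorPower.ιMulti_apply_coe, ExteriorAlgebra.ιMulti_apply, ExteriorAlgebra.ιMulti_apply]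
      have := mul_prod_ι_eq hp (List.ofFn v) U hU
      simpa only [List.map_ofFn, Function.comp_def] using this
    | zero => simp
    | add x y _ _ hx hy => simp only [map_add, Submodule.coe_add, mul_add, hx, hy]
    | smul a x _ hx => simp only [map_smul, Submodule.coe_smul, mul_smul_comm, hx]
  rw [key, key y', exteriorPower.map_comp, LinearMap.comp_apply, LinearMap.comp_apply, h]

theorem ιMulti_mul_ι_eq_zero {i : ℕ} (u : Fin i → X) {x : X}
    (hx : x ∈ Submodule.span F (Set.range u)) :
    ExteriorAlgebra.ιMulti F i u * ExteriorAlgebra.ι F x = 0 := by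
  induction hx using Submodule.span_induction with
  | mem x hx =>
    obtain ⟨a, rfl⟩ := hx
    have h1 : ExteriorAlgebra.ι F (u a) = ExteriorAlgebra.ιMulti F 1 fun _ => u a := by
      simp [ExteriorAlgebra.ιMulti_apply]
    rw [h1, ← ιMulti_concat rfl, concat_rfl]
    refine AlternatingMap.map_eq_zero_of_eq _ _ (i := Fin.castAdd 1 a) (j := Fin.natAdd i 0)
      (by simp) ?_
    intro h
    have := congrArg Fin.val h
    simp at this
    omega
  | zero => simp
  | add x y _ _ hx hy => rw [map_add, mul_add, hx, hy, add_zero]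
  | smul a x _ hx => rw [map_smul, mul_smul_comm, hx, smul_zero]

section Splittings

variable {W I : Submodule F X} (hI : I ≤ W) {r n : ℕ} (e : Basis (Fin (finrank F I)) F I)
  {m : Fin r → W}

theorem span_range_inclusion :
    Submodule.span F (Set.range (Submodule.inclusion hI ∘ e)) = I.submoduleOf W := by
  rw [Set.range_comp, Submodule.span_image, e.span_eq, Submodule.map_top,
    Submodule.range_inclusion]
  rfl

/-- The basis of `W / I` given by vectors that complete a basis of `I` to one of `W`. -/
theorem exists_quotient_basis [FiniteDimensional F X] (h : finrank F I + r = n)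
    (hW : finrank F W = n) (hli : LinearIndependent F (concat h (Submodule.inclusion hI ∘ e) m)) :
    ∃ b : Basis (Fin r) F (W ⧸ I.submoduleOf W), ⇑b = (I.submoduleOf W).mkQ ∘ m := by
  rw [linearIndependent_concat, linearIndependent_sum] at hli
  obtain ⟨-, h2, h3⟩ := hli
  rw [Sum.elim_comp_inl, Sum.elim_comp_inr, span_range_inclusion hI e] at h3
  rw [Sum.elim_comp_inr] at h2
  have hq : LinearIndependent F ((I.submoduleOf W).mkQ ∘ m) :=
    h2.map (by rw [Submodule.ker_mkQ]; exact h3.symm)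
  have hc : Fintype.card (Fin r) = finrank F (W ⧸ I.submoduleOf W) := by
    have h4 := Submodule.finrank_quotient_add_finrank (I.submoduleOf W)
    rw [(Submodule.submoduleOfEquivOfLe hI).finrank_eq] at h4
    rw [Fintype.card_fin]
    omega
  exact ⟨basisOfLinearIndependentOfCardEqFinrank' _ hq hc, by simp⟩

theorem coe_ιMulti_concat (h : finrank F I + r = n) :
    (exteriorPower.ιMulti F n (concat h (Submodule.inclusion hI ∘ e) m) : ExteriorAlgebra F W) =
      ExteriorAlgebra.map (Submodule.inclusion hI)
        (exteriorPower.ιMulti F (finrank F I) e : ExteriorAlgebra F I) *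
        (exteriorPower.ιMulti F r m : ExteriorAlgebra F W) := by
  rw [exteriorPower.ιMulti_apply_coe, exteriorPower.ιMulti_apply_coe,
    exteriorPower.ιMulti_apply_coe, ιMulti_concat, ExteriorAlgebra.map_apply_ιMulti]

theorem nonempty_orientSplitting (h : finrank F I + r = n) {o : ⋀[F]^n W} {c : F}
    (ho : o = c • exteriorPower.ιMulti F n (concat h (Submodule.inclusion hI ∘ e) m)) :
    Nonempty (OrientSplitting hI r o) := by
  refine ⟨⟨c • exteriorPower.ιMulti F _ e, exteriorPower.map r (I.submoduleOf W).mkQ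
    (exteriorPower.ιMulti F r m), exteriorPower.ιMulti F r m, rfl, ?_⟩⟩
  rw [ho, Submodule.coe_smul, Submodule.coe_smul, coe_ιMulti_concat, map_smul, smul_mul_assoc]

/-- Both factors live on lines, so a splitting amounts to two coordinates; only their product is
fixed by `o`. -/
theorem OrientSplitting.exists_eq_smul [FiniteDimensional F X] (h : finrank F I + r = n)
    (hW : finrank F W = n) (hli : LinearIndependent F (concat h (Submodule.inclusion hI ∘ e) m))
    {o : ⋀[F]^n W} (s : OrientSplitting hI r o) :
    ∃ c d : F, s.sub = c • exteriorPower.ιMulti F _ e ∧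
      s.quot = d • exteriorPower.ιMulti F r ((I.submoduleOf W).mkQ ∘ m) ∧
      o = (c * d) • exteriorPower.ιMulti F n (concat h (Submodule.inclusion hI ∘ e) m) := by
  obtain ⟨b, hb⟩ := exists_quotient_basis hI e h hW hli
  obtain ⟨y, hy, hspec⟩ := s.spec
  obtain ⟨c, hc⟩ := exists_eq_smul_ιMulti_basis e s.sub
  obtain ⟨d, hd⟩ := exists_eq_smul_ιMulti_basis b s.quot
  rw [hb] at hd
  refine ⟨c, d, hc, hd, Subtype.ext ?_⟩
  rw [hspec, Submodule.coe_smul, coe_ιMulti_concat, hc, Submodule.coe_smul, map_smul,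
    smul_mul_assoc, mul_smul]
  congr 1
  -- The lift `y` and `d` times the wedge of `m` agree modulo `I`, and a top form of `I` kills `I`.
  rw [← mul_smul_comm, ← Submodule.coe_smul]
  refine mul_eq_of_map_mkQ_eq (N := I.submoduleOf W) (fun x hx => ?_) ?_
  · rw [exteriorPower.ιMulti_apply_coe, ExteriorAlgebra.map_apply_ιMulti]
    exact ιMulti_mul_ι_eq_zero _ (by rwa [span_range_inclusion hI e])
  · rw [hy, hd, map_smul, exteriorPower.map_apply_ιMulti]

end Splittings

end ExteriorPowers

/-! ### Normalization constants in coordinates. -/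

section Constants

variable {F V : Type*} [Field F] [AddCommGroup V] [Module F V]
  {ω : LinearMap.BilinForm F V} {n : ℕ}

theorem finrank_inter_add_halfDim [FiniteDimensional F V] (hAlt : ω.IsAlt)
    (hnd : ω.Nondegenerate) (hn : finrank F V = 2 * n) (M L : OLag ω n) :
    finrank F (inter M L) + halfDim M L = n := by
  have h0 : inter M L ≤ ω.orthogonal (inter M L) := by
    rw [M.isLagrangian.orthogonal_inf hAlt hnd L.isLagrangian]
    exact inf_le_left.trans le_sup_left
  have h1 := LinearMap.BilinForm.finrank_orthogonal hnd (inter M L)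
  have h2 := Submodule.finrank_quotient_add_finrank
    ((inter M L).submoduleOf (ω.orthogonal (inter M L)))
  rw [(Submodule.submoduleOfEquivOfLe h0).finrank_eq] at h2
  have h3 := Submodule.finrank_mono (inter_le_left M L)
  rw [M.isLagrangian.finrank_eq hAlt hnd hn] at h3
  rw [halfDim]
  omega

theorem exists_eq_smul_ιMulti [FiniteDimensional F V] (hAlt : ω.IsAlt) (hnd : ω.Nondegenerate)
    (hn : finrank F V = 2 * n) (L : OLag ω n) {x : Fin n → L.carrier}
    (hx : LinearIndependent F x) :
    ∃ a : F, a ≠ 0 ∧ L.orient = a • exteriorPower.ιMulti F n x := by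
  let b := basisOfLinearIndependentOfCardEqFinrank' x hx
    (by rw [Fintype.card_fin, L.isLagrangian.finrank_eq hAlt hnd hn])
  obtain ⟨a, ha⟩ := exists_eq_smul_ιMulti_basis b L.orient
  have hb : ⇑b = x := by simp [b]
  rw [hb] at ha
  refine ⟨a, ?_, ha⟩
  rintro rfl
  exact L.orient_ne_zero (by rw [ha, zero_smul])

theorem exists_transversal [Fintype F] [FiniteDimensional F V] (hF : ringChar F ≠ 2)
    (hAlt : ω.IsAlt) (hnd : ω.Nondegenerate) (hn : finrank F V = 2 * n) (N M L : OLag ω n) :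
    ∃ K : OLag ω n, K.carrier ⊔ N.carrier = ⊤ ∧ K.carrier ⊔ M.carrier = ⊤ ∧
      K.carrier ⊔ L.carrier = ⊤ := by
  obtain ⟨K, hK, hKj⟩ := exists_isLagrangian_sup_eq_top hF hAlt hnd hn
    (fun j => (![N, M, L] j).carrier) fun j => (![N, M, L] j).isLagrangian
  exact ⟨⟨K, hK, exteriorPower.ιMulti F n (finBasisOfFinrankEq F K (hK.finrank_eq hAlt hnd hn)),
    ιMulti_basis_ne_zero _⟩, hKj 0, hKj 1, hKj 2⟩

variable [Fintype F] [DecidableEq F] {ψ : AddChar F ℂ}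

/-- The sign built into `wedgePairing` cancels the sign of the ansatz. -/
theorem genericConst_eq {M L : OLag ω n} {x : Fin n → L.carrier} {y : Fin n → M.carrier} {a b : F}
    (hL : L.orient = a • exteriorPower.ιMulti F n x)
    (hM : M.orient = b • exteriorPower.ιMulti F n y) :
    genericConst ψ M L = (gaussOne ψ / (Fintype.card F : ℂ)) ^ n *
      (quadraticChar F (a * b * (Matrix.of fun s t => pairing M L (x s) (y t)).det) : ℂ) := by
  have hs : ((-1 : F) ^ n.choose 2) * (-1) ^ n.choose 2 = 1 := by
    rw [← mul_pow]; simp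
  rw [genericConst, hL, hM, map_smul, map_smul, LinearMap.smul_apply, wedgePairing_ιMulti,
    smul_eq_mul, smul_eq_mul]
  congr 3
  linear_combination
    (a * b * (Matrix.of fun s t => pairing M L (x s) (y t)).det) * hs

theorem normConst_eq [FiniteDimensional F V] (hAlt : ω.IsAlt) (hnd : ω.Nondegenerate)
    (hn : finrank F V = 2 * n) {M L : OLag ω n} (h : finrank F (inter M L) + halfDim M L = n)
    (sM : OrientSplitting (inter_le_left M L) (halfDim M L) M.orient)
    (sL : OrientSplitting (inter_le_right M L) (halfDim M L) L.orient)
    (e : Basis (Fin (finrank F (inter M L))) F (inter M L))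
    {l : Fin (halfDim M L) → L.carrier} {m : Fin (halfDim M L) → M.carrier}
    (hl : LinearIndependent F (concat h (Submodule.inclusion (inter_le_right M L) ∘ e) l))
    (hm : LinearIndependent F (concat h (Submodule.inclusion (inter_le_left M L) ∘ e) m))
    {a b : F} (ha : L.orient = a • exteriorPower.ιMulti F n
      (concat h (Submodule.inclusion (inter_le_right M L) ∘ e) l))
    (hb : M.orient = b • exteriorPower.ιMulti F n
      (concat h (Submodule.inclusion (inter_le_left M L) ∘ e) m)) :
    normConst ψ M L sM sL = (gaussOne ψ / (Fintype.card F : ℂ)) ^ halfDim M L *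
      (quadraticChar F (a * b * (Matrix.of fun s t => ω (l s) (m t)).det) : ℂ) := by
  obtain ⟨c, d, hc, hd, hcd⟩ := sL.exists_eq_smul _ e h (L.isLagrangian.finrank_eq hAlt hnd hn) hl
  obtain ⟨c', d', hc', hd', hcd'⟩ :=
    sM.exists_eq_smul _ e h (M.isLagrangian.finrank_eq hAlt hnd hn) hm
  have hac : a = c * d := by
    have h1 := ha.symm.trans hcd
    refine eq_of_smul_eq_smul_right (X := ⋀[F]^n L.carrier) h1
      fun h0 => L.orient_ne_zero ?_
    rw [ha, h0, smul_zero]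
  have hbc : b = c' * d' := by
    have h1 := hb.symm.trans hcd'
    refine eq_of_smul_eq_smul_right (X := ⋀[F]^n M.carrier) h1
      fun h0 => M.orient_ne_zero ?_
    rw [hb, h0, smul_zero]
  have hc0 : c' ≠ 0 := by
    rintro rfl
    exact M.orient_ne_zero (by rw [hcd', zero_mul, zero_smul])
  -- Existence of the scalar and `sM.sub ≠ 0` pin down the value picked by `epsilon`.
  have hratio : lineRatio (F := F) sL.sub sM.sub = c / c' := by
    have h1 : sL.sub = (c / c') • sM.sub := by
      rw [hc, hc', smul_smul, div_mul_cancel₀ _ hc0]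
    have h2 : sL.sub = lineRatio (F := F) sL.sub sM.sub • sM.sub :=
      Classical.epsilon_spec (p := fun c : F => sL.sub = c • sM.sub) ⟨_, h1⟩
    refine eq_of_smul_eq_smul_right
      (X := ⋀[F]^(finrank F (inter M L)) (inter M L)) (h2.symm.trans h1) ?_
    rw [hc']
    exact smul_ne_zero hc0 (ιMulti_basis_ne_zero e)
  have hs : ((-1 : F) ^ (halfDim M L).choose 2) * (-1) ^ (halfDim M L).choose 2 = 1 := by
    rw [← mul_pow]; simp
  rw [normConst, hratio, hd, hd', map_smul, map_smul, LinearMap.smul_apply, wedgePairing_ιMulti,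
    smul_eq_mul, smul_eq_mul]
  have hdet : (Matrix.of fun s t => quotPairing M L
      ((((inter M L).submoduleOf L.carrier).mkQ ∘ l) s)
      ((((inter M L).submoduleOf M.carrier).mkQ ∘ m) t)) =
      Matrix.of fun s t => ω (l s) (m t) := rfl
  rw [hdet, hac, hbc]
  -- The quotient `c / c'` and the product `c * c'` differ by the square `c' * c'`, which `σ` does
  -- not see. This is why the choice of splittings is immaterial.
  have hfield : (-1) ^ (halfDim M L).choose 2 * (c / c') * (d' * (d *
      ((-1) ^ (halfDim M L).choose 2 * (Matrix.of fun s t => ω (l s) (m t)).det))) * (c' * c') =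
      c * d * (c' * d') * (Matrix.of fun s t => ω (l s) (m t)).det := by
    field_simp
    linear_combination (c * d * d' * (Matrix.of fun s t => ω (l s) (m t)).det) * hs
  rw [← hfield, quadraticChar_cast_mul _ (c' * c'), quadraticChar_cast_mul c' c',
    quadraticChar_cast_mul_self hc0, mul_one]

/-- Here `s = σ(-1)`, `A`, `B`, `C` are `σ` of the orientation coordinates of `L`, `M`, `K`, and `D`
is `σ` of the common determinant. The signs `s ^ i` and `s ^ r` combine with the `2 (i + r)` factors
`G / q` to give `q⁻¹ ^ (i + r)`, and `C` cancels. -/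
theorem normalization_identity {G q s A B C D : ℂ} {i r : ℕ} (hq : q ≠ 0) (hG : G ^ 2 = s * q)
    (hs : s * s = 1) (hC : C * C = 1) (hD : D * D = 1) :
    (G / q) ^ (i + r) * (C * B * (s ^ i * D)) * ((G / q) ^ (i + r) * (A * C * D)) *
      (G ^ r * (s ^ r * D)) * q ^ i = (G / q) ^ r * (A * B * D) := by
  have h1 : G / q * (G / q) * s = q⁻¹ := by
    field_simp
    rw [hG]
    linear_combination q * hs
  calc _ = (G / q * (G / q) * s) ^ (i + r) * (C * C) * (D * D) * (A * B * D) * G ^ r * q ^ i := by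
        ring
    _ = _ := by
        rw [h1, hC, hD, div_pow, pow_add, inv_pow, inv_pow]
        field_simp

end Constants

/-! ### Composition of generic morphisms through a transversal. -/

section Morphisms

variable {F V : Type*} [Field F] [Fintype F] [DecidableEq F] [AddCommGroup V] [Module F V]
  [FiniteDimensional F V] {ω : LinearMap.BilinForm F V} {n : ℕ} {ψ : AddChar F ℂ}

/-- The normalized averaging morphism for Lagrangians in general position. -/
noncomputable def genericMorphism (ψ : AddChar F ℂ) (M L : OLag ω n) :
    model ω ψ L.carrier →ₗ[ℂ] model ω ψ M.carrier :=
  genericConst ψ M L • fullAverage ψ M L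

theorem genericMorphism_rep (M L : OLag ω n) (h : Heisenberg ω) (f : model ω ψ L.carrier) :
    genericMorphism ψ M L (rep ω ψ L.carrier h f) =
      rep ω ψ M.carrier h (genericMorphism ψ M L f) := by
  rw [genericMorphism, LinearMap.smul_apply, LinearMap.smul_apply, fullAverage_rep, map_smul]

/-- The composition of the generic morphisms through a common transversal, computed in adapted
families. -/
theorem exists_families_comp (hF : ringChar F ≠ 2) (hAlt : ω.IsAlt) (hnd : ω.Nondegenerate)
    (hn : finrank F V = 2 * n) (hψ : ψ ≠ 1) {M K L : OLag ω n}
    (hKM : K.carrier ⊔ M.carrier = ⊤) (hKL : K.carrier ⊔ L.carrier = ⊤) {r : ℕ}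
    (h : finrank F (inter M L) + r = n) :
    ∃ (e : Basis (Fin (finrank F (inter M L))) F (inter M L)) (l : Fin r → L.carrier)
      (m : Fin r → M.carrier) (a b : F), a ≠ 0 ∧ b ≠ 0 ∧
      LinearIndependent F (concat h (Submodule.inclusion (inter_le_right M L) ∘ e) l) ∧
      LinearIndependent F (concat h (Submodule.inclusion (inter_le_left M L) ∘ e) m) ∧
      L.orient = a • exteriorPower.ιMulti F n
        (concat h (Submodule.inclusion (inter_le_right M L) ∘ e) l) ∧
      M.orient = b • exteriorPower.ιMulti F n
        (concat h (Submodule.inclusion (inter_le_left M L) ∘ e) m) ∧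
      genericMorphism ψ M K ∘ₗ genericMorphism ψ K L =
        ((gaussOne ψ / (Fintype.card F : ℂ)) ^ r *
          (quadraticChar F (a * b * (Matrix.of fun s t => ω (l s) (m t)).det) : ℂ)) •
          average ψ M L := by
  have : Finite V := Module.finite_of_finite F
  have := Fintype.ofFinite ((M.carrier ⊔ L.carrier).submoduleOf K.carrier)
  obtain ⟨lam, mu, hdec⟩ := exists_decomposition K.carrier L.carrier M.carrier
  obtain ⟨e, k, w, l, m, hek, hew, hwlm, hdet, hsum⟩ := exists_adapted_families hF hAlt hnd hn hψ
    K.isLagrangian L.isLagrangian M.isLagrangian hKL hKM rfl h lam mu hdec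
  set D := (Matrix.of fun s t => ω (l s) (m t)).det with hD
  -- The duality of `e`, `k` and the orthogonality of `e`, `w` make this matrix block lower
  -- triangular with diagonal blocks `1` and `ω(l s, m t)`.
  have hLK : (Matrix.of fun s t => pairing K L
      (concat h (Submodule.inclusion (inter_le_right M L) ∘ e) l s) (concat h k w t)).det = D := by
    rw [det_concat]
    have h1 : (Matrix.of fun a b => pairing K L
        ((Submodule.inclusion (inter_le_right M L) ∘ e) a) (k b)) = 1 := by
      ext a b
      exact (hek a b).trans (Matrix.one_apply).symm
    have h2 : (Matrix.of fun a s => pairing K L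
        ((Submodule.inclusion (inter_le_right M L) ∘ e) a) (w s)) = 0 := by
      ext a s
      exact hew a s
    have h3 : (Matrix.of fun s t => pairing K L (l s) (w t)) =
        Matrix.of fun s t => ω (l s) (m t) := by
      ext s t
      change ω (l s) (w t) = ω (l s) (m t)
      rw [hwlm, map_add, L.isLagrangian.apply_eq_zero (l s).2 (l t).2, zero_add]
    rw [h1, h2, h3, Matrix.det_fromBlocks_zero₁₂, Matrix.det_one, one_mul]
  -- Block upper triangular; antisymmetry turns the first diagonal block into `-1`, whence the sign.
  have hKM' : (Matrix.of fun s t => pairing M K (concat h k w s)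
      (concat h (Submodule.inclusion (inter_le_left M L) ∘ e) m t)).det =
      (-1) ^ finrank F (inter M L) * D := by
    rw [det_concat]
    have h1 : (Matrix.of fun a b => pairing M K (k a)
        ((Submodule.inclusion (inter_le_left M L) ∘ e) b)) = -1 := by
      ext a b
      change ω (k a) (e b) = _
      rw [← hAlt.neg_eq, hek, Matrix.neg_apply, Matrix.one_apply]
      simp only [eq_comm]
    have h2 : (Matrix.of fun s a => pairing M K (w s)
        ((Submodule.inclusion (inter_le_left M L) ∘ e) a)) = 0 := by
      ext s a
      exact hAlt.isRefl _ _ (hew a s)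
    have h3 : (Matrix.of fun s t => pairing M K (w s) (m t)) =
        Matrix.of fun s t => ω (l s) (m t) := by
      ext s t
      change ω (w s) (m t) = ω (l s) (m t)
      rw [hwlm, map_add, LinearMap.add_apply, M.isLagrangian.apply_eq_zero (m s).2 (m t).2,
        add_zero]
    rw [h1, h2, h3, Matrix.det_fromBlocks_zero₂₁, Matrix.det_neg, Matrix.det_one, mul_one,
      Fintype.card_fin]
  have hLK0 := hLK.trans_ne hdet
  have hKM0 := hKM'.trans_ne (mul_ne_zero (pow_ne_zero _ (neg_ne_zero.2 one_ne_zero)) hdet)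
  have hl := linearIndependent_left_of_det_ne_zero _ hLK0
  have hm := linearIndependent_right_of_det_ne_zero _ hKM0
  obtain ⟨a, ha0, ha⟩ := exists_eq_smul_ιMulti hAlt hnd hn L hl
  obtain ⟨b, hb0, hb⟩ := exists_eq_smul_ιMulti hAlt hnd hn M hm
  obtain ⟨c, hc0, hc⟩ := exists_eq_smul_ιMulti hAlt hnd hn K
    (linearIndependent_right_of_det_ne_zero _ hLK0)
  refine ⟨e, l, m, a, b, ha0, hb0, hl, hm, ha, hb, ?_⟩
  rw [genericMorphism, genericMorphism, LinearMap.smul_comp, LinearMap.comp_smul,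
    fullAverage_comp_fullAverage (Ring.two_ne_zero hF) hAlt hnd hψ M K L lam mu hdec, hsum,
    fullAverage_eq_smul_average, smul_smul, smul_smul, smul_smul, genericConst_eq ha hc,
    genericConst_eq hc hb, hLK, hKM']
  congr 1
  have hid := normalization_identity (G := gaussOne ψ) (q := Fintype.card F)
    (s := quadraticChar F (-1)) (A := quadraticChar F a) (B := quadraticChar F b)
    (C := quadraticChar F c) (D := quadraticChar F D) (i := finrank F (inter M L)) (r := r)
    (Nat.cast_ne_zero.2 Fintype.card_ne_zero) (gaussOne_sq hF hψ)
    (quadraticChar_cast_mul_self (neg_ne_zero.2 one_ne_zero)) (quadraticChar_cast_mul_self hc0)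
    (quadraticChar_cast_mul_self hdet)
  rw [h] at hid
  simp only [quadraticChar_cast_mul, quadraticChar_cast_neg_one_pow]
  rw [← hid]

theorem nonempty_orientSplittings (hF : ringChar F ≠ 2) (hAlt : ω.IsAlt) (hnd : ω.Nondegenerate)
    (hn : finrank F V = 2 * n) (hψ : ψ ≠ 1) {M K L : OLag ω n}
    (hKM : K.carrier ⊔ M.carrier = ⊤) (hKL : K.carrier ⊔ L.carrier = ⊤) :
    Nonempty (OrientSplitting (inter_le_left M L) (halfDim M L) M.orient) ∧
      Nonempty (OrientSplitting (inter_le_right M L) (halfDim M L) L.orient) := by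
  have h := finrank_inter_add_halfDim hAlt hnd hn M L
  obtain ⟨e, l, m, a, b, -, -, -, -, ha, hb, -⟩ :=
    exists_families_comp hF hAlt hnd hn hψ hKM hKL h
  exact ⟨nonempty_orientSplitting _ e h hb, nonempty_orientSplitting _ e h ha⟩

/-- The right side does not mention `K`, and the left side does not mention the splittings, so this
yields independence of both. -/
theorem genericMorphism_comp_eq_normConst (hF : ringChar F ≠ 2) (hAlt : ω.IsAlt)
    (hnd : ω.Nondegenerate) (hn : finrank F V = 2 * n) (hψ : ψ ≠ 1) {M K L : OLag ω n}
    (hKM : K.carrier ⊔ M.carrier = ⊤) (hKL : K.carrier ⊔ L.carrier = ⊤)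
    (sM : OrientSplitting (inter_le_left M L) (halfDim M L) M.orient)
    (sL : OrientSplitting (inter_le_right M L) (halfDim M L) L.orient) :
    genericMorphism ψ M K ∘ₗ genericMorphism ψ K L = normConst ψ M L sM sL • average ψ M L := by
  have h := finrank_inter_add_halfDim hAlt hnd hn M L
  obtain ⟨e, l, m, a, b, -, -, hl, hm, ha, hb, hcomp⟩ :=
    exists_families_comp hF hAlt hnd hn hψ hKM hKL h
  rw [hcomp, normConst_eq hAlt hnd hn h sM sL e hl hm ha hb]

/-- The case `I = 0`, `r = n`: the adapted families have no `e`-part, and the coefficient is the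
generic constant itself. -/
theorem genericMorphism_comp_of_sup_eq_top (hF : ringChar F ≠ 2) (hAlt : ω.IsAlt)
    (hnd : ω.Nondegenerate) (hn : finrank F V = 2 * n) (hψ : ψ ≠ 1) {M K L : OLag ω n}
    (hKM : K.carrier ⊔ M.carrier = ⊤) (hKL : K.carrier ⊔ L.carrier = ⊤)
    (hLM : L.carrier ⊔ M.carrier = ⊤) :
    genericMorphism ψ M K ∘ₗ genericMorphism ψ K L = genericMorphism ψ M L := by
  have h0 : finrank F (inter M L) = 0 := by
    rw [inter, inf_comm, L.isLagrangian.inf_eq_bot hnd M.isLagrangian hLM, finrank_bot]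
  have h : finrank F (inter M L) + n = n := by rw [h0, zero_add]
  obtain ⟨e, l, m, a, b, -, -, -, -, ha, hb, hcomp⟩ :=
    exists_families_comp hF hAlt hnd hn hψ hKM hKL h
  have hdet : (Matrix.of fun s t => pairing M L
      (concat h (Submodule.inclusion (inter_le_right M L) ∘ e) l s)
      (concat h (Submodule.inclusion (inter_le_left M L) ∘ e) m t)).det =
      (Matrix.of fun s t => ω (l s) (m t)).det := by
    have : IsEmpty (Fin (finrank F (inter M L))) := by rw [h0]; infer_instance
    rw [det_concat]
    have h2 : (Matrix.of fun c s => pairing M L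
        ((Submodule.inclusion (inter_le_right M L) ∘ e) c) (m s)) = 0 := by
      ext c
      exact isEmptyElim c
    rw [h2, Matrix.det_fromBlocks_zero₁₂, Matrix.det_isEmpty, one_mul]
    rfl
  rw [hcomp, genericMorphism, genericConst_eq ha hb, hdet, fullAverage_eq_smul_average, h0,
    pow_zero, one_smul]

/-- The case `I = L`, `r = 0`: the determinant is empty and the orientation enters only through
`σ(a) ^ 2 = 1`. -/
theorem genericMorphism_comp_self (hF : ringChar F ≠ 2) (hAlt : ω.IsAlt)
    (hnd : ω.Nondegenerate) (hn : finrank F V = 2 * n) (hψ : ψ ≠ 1) {K L : OLag ω n}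
    (hKL : K.carrier ⊔ L.carrier = ⊤) :
    genericMorphism ψ L K ∘ₗ genericMorphism ψ K L = LinearMap.id := by
  have h : finrank F (inter L L) + 0 = n := by
    rw [inter, inf_idem, add_zero, L.isLagrangian.finrank_eq hAlt hnd hn]
  obtain ⟨e, l, m, a, b, ha0, -, -, -, ha, hb, hcomp⟩ :=
    exists_families_comp hF hAlt hnd hn hψ hKL hKL h
  obtain rfl : l = m := Subsingleton.elim _ _
  obtain rfl : a = b := by
    refine eq_of_smul_eq_smul_right (X := ⋀[F]^n L.carrier) (ha.symm.trans hb)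
      fun h0 => L.orient_ne_zero ?_
    rw [ha, h0, smul_zero]
  rw [hcomp, Matrix.det_isEmpty, mul_one, quadraticChar_cast_mul, quadraticChar_cast_mul_self ha0,
    pow_zero, one_mul, one_smul, average_self]

end Morphisms

end StrongSvN

/-! ### Existence, uniqueness and the explicit formula. -/

theorem mainTheorem4 {F V : Type*} [Field F] [Fintype F] [DecidableEq F] (hF : ringChar F ≠ 2)
    [AddCommGroup V] [Module F V] [FiniteDimensional F V]
    (ω : LinearMap.BilinForm F V) (hAlt : ω.IsAlt) (hnd : ω.Nondegenerate)
    (n : ℕ) (hn : Module.finrank F V = 2 * n) (ψ : AddChar F ℂ) (hψ : ψ ≠ 1) :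
    (∃! T : System ω n ψ, IsCanonical ψ T) ∧
    ∀ T : System ω n ψ, IsCanonical ψ T → ∀ M L : OLag ω n,
      Nonempty (OrientSplitting (inter_le_left M L) (halfDim M L) M.orient) ∧
      Nonempty (OrientSplitting (inter_le_right M L) (halfDim M L) L.orient) ∧
      ∀ (sM : OrientSplitting (inter_le_left M L) (halfDim M L) M.orient)
        (sL : OrientSplitting (inter_le_right M L) (halfDim M L) L.orient),
        T M L = normConst ψ M L sM sL • average ψ M L := by
  have htr := exists_transversal hF hAlt hnd hn
  have hcanon : ∀ T : System ω n ψ, IsCanonical ψ T → ∀ M K L : OLag ω n,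
      K.carrier ⊔ M.carrier = ⊤ → K.carrier ⊔ L.carrier = ⊤ →
      T M L = genericMorphism ψ M K ∘ₗ genericMorphism ψ K L := by
    intro T hT M K L hKM hKL
    rw [← hT.mult M K L, hT.ansatz M K hKM, hT.ansatz K L (sup_comm L.carrier _ ▸ hKL)]
    rfl
  refine ⟨?_, fun T hT M L => ?_⟩
  · choose κ hκM hκL _ using fun M L : OLag ω n => htr M L L
    let T : System ω n ψ := fun M L =>
      genericMorphism ψ M (κ M L) ∘ₗ genericMorphism ψ (κ M L) L
    -- Any transversal may replace the chosen `κ M L`, since both composites equal the same multiple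
    -- of `average ψ M L`.
    have hT : ∀ {M K L : OLag ω n}, K.carrier ⊔ M.carrier = ⊤ → K.carrier ⊔ L.carrier = ⊤ →
        T M L = genericMorphism ψ M K ∘ₗ genericMorphism ψ K L := by
      intro M K L hKM hKL
      obtain ⟨⟨sM⟩, ⟨sL⟩⟩ := nonempty_orientSplittings hF hAlt hnd hn hψ hKM hKL
      rw [genericMorphism_comp_eq_normConst hF hAlt hnd hn hψ hKM hKL sM sL]
      exact genericMorphism_comp_eq_normConst hF hAlt hnd hn hψ (hκM M L) (hκL M L) sM sL
    have hself : ∀ L, T L L = LinearMap.id := fun L =>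
      genericMorphism_comp_self hF hAlt hnd hn hψ (hκL L L)
    have hmult : ∀ N M L, T N M ∘ₗ T M L = T N L := by
      intro N M L
      -- With one `K` for all three pairs, the middle factors `K → M → K` cancel.
      obtain ⟨K, hKN, hKM, hKL⟩ := htr N M L
      rw [hT hKN hKM, hT hKM hKL, hT hKN hKL, LinearMap.comp_assoc,
        ← LinearMap.comp_assoc (genericMorphism ψ K L),
        genericMorphism_comp_self hF hAlt hnd hn hψ (sup_comm K.carrier _ ▸ hKM),
        LinearMap.id_comp]
    refine ⟨T, ⟨⟨fun M L h f => ?_, fun M L => ?_, hmult⟩, fun M L hLM => ?_⟩, fun T' hT' => ?_⟩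
    · change genericMorphism ψ M _ (genericMorphism ψ _ L _) = _
      rw [genericMorphism_rep, genericMorphism_rep]
      rfl
    · refine Function.bijective_iff_has_inverse.2 ⟨T L M, fun f => ?_, fun f => ?_⟩
      · exact LinearMap.congr_fun ((hmult L M L).trans (hself L)) f
      · exact LinearMap.congr_fun ((hmult M L M).trans (hself M)) f
    · exact genericMorphism_comp_of_sup_eq_top hF hAlt hnd hn hψ (hκM M L) (hκL M L) hLM
    · funext M L
      exact hcanon T' hT' M _ L (hκM M L) (hκL M L)
  · obtain ⟨K, hKM, hKL, _⟩ := htr M L L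
    obtain ⟨h1, h2⟩ := nonempty_orientSplittings hF hAlt hnd hn hψ hKM hKL
    refine ⟨h1, h2, fun sM sL => ?_⟩
    rw [hcanon T hT M K L hKM hKL]
    exact genericMorphism_comp_eq_normConst hF hAlt hnd hn hψ hKM hKL sM sL
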